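/- Let $\mathbb{K}=\mathbb{R}$ or $\mathbb{C}$, let $V$ be a finite-dimensional vector space over $\mathbb{K}$ and let $\mathcal{P}=\{A_\lambda=A+\lambda B\mid \lambda\in\mathbb{K}\cup\{\infty\}\}$, $A_\infty=B$, be a pencil of skew-symmetric bilinear forms on $V$. Let $n_1>n_2>\dots>n_t\ge 1$ and $l_1,\dots,l_t$ be integers, $l_i\ge 0$. A basis $e^{ij}_k, f^{ij}_k$ of $V$ ($1\le i\le t$, $1\le j\le l_i$, $1\le k\le n_i$) is called standard if \[ B(e^{ij}_k,f^{ij}_k)=1,\qquad A(e^{ij}_k,f^{ij}_{k+1})=1, \] and all other values of $A$ and $B$ on pairs of basis vectors, up to skew-symmetry, are $0$. Assume that $(V,\mathcal{P})=\bigoplus_{i=1}^t\bigoplus_{j=1}^{l_i}\mathcal{J}_{0,2n_i}$ is a sum of Jordan blocks with eigenvalue $0$, i.e. that a standard basis exists. Then $B$ is nondegenerate; let $P=B^{-1}A$, i.e. $B(Pu,v)=A(u,v)$, be the (nilpotent) recursion operator. A subspace $L\subset V$ is bi-Lagrangian if all forms $A_\lambda$ vanish on $L$ and $\dim L=\dim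 V-\frac12\max_\lambda\operatorname{rk}A_\lambda$. Let $\operatorname{BLG}(V,\mathcal{P})$ be the set of bi-Lagrangian subspaces, and let $\operatorname{Aut}(V,\mathcal{P})$ be the group of linear automorphisms of $V$ that preserve every $A_\lambda$; it acts on $\operatorname{BLG}(V,\mathcal{P})$. The dimension of the orbit of $L$ is its dimension over $\mathbb{K}$ as a homogeneous space of a Lie group: $\dim\operatorname{Aut}(V,\mathcal{P})-\dim\operatorname{St}_L$, where $\operatorname{St}_L$ is the stabilizer of $L$. Then among the $\operatorname{Aut}(V,\mathcal{P})$-orbits in $\operatorname{BLG}(V,\mathcal{P})$ there is exactly one, $O_{\max}$, of maximal dimension, and for every bi-Lagrangian subspace $L\subset(V,\mathcal{P})$ the following conditions are equivalent. \begin{enumerate} \item $L$ belongs to $O_{\max}$. \item For each $j=1,\dots,t$, with $W_j=\left(\operatorname{Ker}P^{n_j}\cap\operatorname{Im}P\right)+\operatorname{Ker}P^{n_j-1}$, \[ \dim\left(\left(L\cap\operatorname{Ker}P^{n_j}+W_j\right)/W_j\right)=l_j. \] \item There is a standard basis $e^{ij}_k,f^{ij}_k$ of $V$ such that $L$ is the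 span of all the vectors $e^{ij}_k$ ($1\le i\le t$, $1\le j\le l_i$, $1\le k\le n_i$). \end{enumerate} -/

import Mathlib

open scoped Pointwise

noncomputable section

namespace BiLagr

section Pencil

variable {𝕜 : Type*} [RCLike 𝕜] {V : Type*} [AddCommGroup V] [Module 𝕜 V]

/-- The forms `A_c = A + c B` of the pencil spanned by `A` and `B`, where the parameter `c` runs
over `𝕜 ∪ {∞}` and `A_∞ = B`. -/
def pencilForm (A B : LinearMap.BilinForm 𝕜 V) : OnePoint 𝕜 → LinearMap.BilinForm 𝕜 V
  | none => B
  | some c => A + c • B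

/-- The rank of the pencil: the maximum of the ranks of its forms (a form is read as a map from
`V` to its dual). -/
def pencilRank (A B : LinearMap.BilinForm 𝕜 V) : ℕ :=
  ⨆ c : OnePoint 𝕜, Module.finrank 𝕜 (LinearMap.range (pencilForm A B c))

/-- `U` is isotropic with respect to all forms of the pencil. -/
def IsBiIsotropic (A B : LinearMap.BilinForm 𝕜 V) (U : Submodule 𝕜 V) : Prop :=
  ∀ c : OnePoint 𝕜, ∀ u ∈ U, ∀ v ∈ U, pencilForm A B c u v = 0

/-- `U` is bi-Lagrangian: it is bi-isotropic and `dim U = dim V - (1/2) rk`, where `rk` is the rank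
of the pencil (the equation is multiplied by `2` and has no subtraction). -/
def IsBiLagrangian (A B : LinearMap.BilinForm 𝕜 V) (U : Submodule 𝕜 V) : Prop :=
  IsBiIsotropic A B U ∧
    2 * Module.finrank 𝕜 U + pencilRank A B = 2 * Module.finrank 𝕜 V

/-- The bi-Lagrangian Grassmannian. -/
def BLG (A B : LinearMap.BilinForm 𝕜 V) : Set (Submodule 𝕜 V) :=
  {L | IsBiLagrangian A B L}

/-- The group of bi-Poisson automorphisms: the linear automorphisms of `V` which preserve all forms
of the pencil. -/
def Aut (A B : LinearMap.BilinForm 𝕜 V) : Subgroup (V ≃ₗ[𝕜] V) where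
  carrier := {g | ∀ c : OnePoint 𝕜, ∀ u v : V,
    pencilForm A B c (g u) (g v) = pencilForm A B c u v}
  one_mem' := fun _ _ _ => rfl
  mul_mem' := fun {g h} hg hh c u v => by
    rw [LinearEquiv.mul_apply, LinearEquiv.mul_apply, hg, hh]
  inv_mem' := fun {g} hg c u v => by
    rw [← hg c (g⁻¹ u) (g⁻¹ v)]
    simp

/-- The `Aut`-orbit of a subspace `L`, the action being `g • L = g(L)`. -/
def autOrbit (A B : LinearMap.BilinForm 𝕜 V) (L : Submodule 𝕜 V) : Set (Submodule 𝕜 V) :=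
  MulAction.orbit (Aut A B) L

/-- The stabilizer of `L` in `Aut`, as a subgroup of the general linear group of `V`. -/
def autStab (A B : LinearMap.BilinForm 𝕜 V) (L : Submodule 𝕜 V) : Subgroup (V ≃ₗ[𝕜] V) :=
  Aut A B ⊓ MulAction.stabilizer (V ≃ₗ[𝕜] V) L

end Pencil

section Dimension

variable {𝕜 : Type*} [RCLike 𝕜] {V : Type*} [AddCommGroup V] [Module 𝕜 V] [FiniteDimensional 𝕜 V]

/-- The exponential of an operator on a finite-dimensional space, computed as the matrix
exponential in a basis (the result does not depend on the basis). -/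
def expEnd (X : V →ₗ[𝕜] V) : V →ₗ[𝕜] V :=
  Matrix.toLin (Module.finBasis 𝕜 V) (Module.finBasis 𝕜 V)
    (NormedSpace.exp (LinearMap.toMatrix (Module.finBasis 𝕜 V) (Module.finBasis 𝕜 V) X))

/-- The Lie algebra of a (closed linear) group `G`: the operators `X` such that the one-parameter
group `t ↦ exp (t X)` lies in `G`. The span of this set is taken only to have a subspace without a
proof; for the Lie subgroups to which this is applied the set is a subspace already. -/
def lieAlg (G : Subgroup (V ≃ₗ[𝕜] V)) : Submodule 𝕜 (V →ₗ[𝕜] V) :=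
  Submodule.span 𝕜 {X | ∀ t : 𝕜, ∃ g ∈ G, (g : V →ₗ[𝕜] V) = expEnd (t • X)}

/-- The dimension of a (closed linear) Lie group over `𝕜`, real if `𝕜 = ℝ` and complex
if `𝕜 = ℂ`. -/
def groupDim (G : Subgroup (V ≃ₗ[𝕜] V)) : ℕ := Module.finrank 𝕜 (lieAlg G)

/-- The Lie algebra of a subgroup is contained in that of the group. -/
theorem groupDim_mono {G H : Subgroup (V ≃ₗ[𝕜] V)} (h : G ≤ H) : groupDim G ≤ groupDim H :=
  Submodule.finrank_mono (Submodule.span_mono fun _ hX t =>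
    let ⟨g, hg, e⟩ := hX t
    ⟨g, h hg, e⟩)

/-- The dimension over `𝕜` of the `Aut`-orbit of `L`, that is, of the homogeneous space
`Aut / Stab_L`: it is `dim Aut - dim Stab_L` (the subtraction does not truncate). -/
def orbitDim (A B : LinearMap.BilinForm 𝕜 V) (L : Submodule 𝕜 V) : ℕ :=
  groupDim (Aut A B) - groupDim (autStab A B L)

/-- `O` is a top-dimensional `Aut`-orbit in the bi-Lagrangian Grassmannian: it is the orbit of some
bi-Lagrangian `L`, and no orbit of a bi-Lagrangian subspace has larger dimension. -/
def IsTopOrbit (A B : LinearMap.BilinForm 𝕜 V) (O : Set (Submodule 𝕜 V)) : Prop :=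
  ∃ L ∈ BLG A B, O = autOrbit A B L ∧ ∀ M ∈ BLG A B, orbitDim A B M ≤ orbitDim A B L

end Dimension

section Jordan

/-- Indices `(i, j, k)` with `j < l i` and `k < n i` (counted from `0`): the `k`-th vector of the
`j`-th block of half-size `n i`. -/
abbrev BlockIndex {t : ℕ} (n l : Fin t → ℕ) : Type := Σ i : Fin t, Fin (l i) × Fin (n i)

variable {𝕜 : Type*} [RCLike 𝕜] {V : Type*} [AddCommGroup V] [Module 𝕜 V]

/-- The block-diagonal matrix of nilpotent upper Jordan blocks, `l i` of them of size `n i`: the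
entry at `((i, j, k), (i, j, k + 1))` is `1`, all other entries are `0`. -/
def jordanMatrix (𝕜 : Type*) [RCLike 𝕜] {t : ℕ} (n l : Fin t → ℕ) :
    Matrix (BlockIndex n l) (BlockIndex n l) 𝕜 :=
  Matrix.of fun x y =>
    if x.1 = y.1 ∧ (x.2.1 : ℕ) = (y.2.1 : ℕ) ∧ (x.2.2 : ℕ) + 1 = (y.2.2 : ℕ) then 1 else 0

/-- The basis `b`, with `e`-vectors `b (Sum.inl (i, j, k))` and `f`-vectors
`b (Sum.inr (i, j, k))`, is a standard basis for a sum of Jordan blocks with eigenvalue `0`,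
`l i` of them of dimension `2 * n i`: the matrices of the forms are `A = (0, J; -Jᵀ, 0)` and
`B = (0, I; -I, 0)` with `J` the sum of nilpotent Jordan blocks. -/
def IsStandardBasis (A B : LinearMap.BilinForm 𝕜 V) {t : ℕ} (n l : Fin t → ℕ)
    (b : Module.Basis (BlockIndex n l ⊕ BlockIndex n l) 𝕜 V) : Prop :=
  LinearMap.BilinForm.toMatrix b A =
      Matrix.fromBlocks 0 (jordanMatrix 𝕜 n l) (-(jordanMatrix 𝕜 n l).transpose) 0 ∧
    LinearMap.BilinForm.toMatrix b B = Matrix.fromBlocks 0 1 (-1) 0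

/-- The space with the pencil spanned by `A` and `B` is the sum over `i` of `l i` Jordan blocks of
dimension `2 * n i` with eigenvalue `0`. Since this prescribes the matrices of both forms in some
basis, `A` and `B` are then skew-symmetric. -/
def IsJordanSum (A B : LinearMap.BilinForm 𝕜 V) {t : ℕ} (n l : Fin t → ℕ) : Prop :=
  ∃ b : Module.Basis (BlockIndex n l ⊕ BlockIndex n l) 𝕜 V, IsStandardBasis A B n l b

theorem IsJordanSum.nondegenerate {A B : LinearMap.BilinForm 𝕜 V} {t : ℕ} {n l : Fin t → ℕ}
    (h : IsJordanSum A B n l) : B.Nondegenerate := by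
  obtain ⟨b, -, hB⟩ := h
  refine LinearMap.BilinForm.nondegenerate_of_det_ne_zero B b ?_
  rw [hB]
  have h2 : (Matrix.fromBlocks 0 1 (-1) 0 :
      Matrix (BlockIndex n l ⊕ BlockIndex n l) (BlockIndex n l ⊕ BlockIndex n l) 𝕜) *
      Matrix.fromBlocks 0 (-1) 1 0 = 1 := by
    simp [Matrix.fromBlocks_multiply]
  intro h0
  have h3 := congrArg Matrix.det h2
  rw [Matrix.det_mul, h0, zero_mul, Matrix.det_one] at h3
  exact zero_ne_one h3

/-- The recursion operator `P = B⁻¹ A`, with `B (P u) v = A u v`. -/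
def recursionOperator [FiniteDimensional 𝕜 V] (A B : LinearMap.BilinForm 𝕜 V)
    (hB : B.Nondegenerate) : V →ₗ[𝕜] V :=
  LinearMap.BilinForm.symmCompOfNondegenerate A B hB

/-- The subspace `W = Ker P^m ∩ Im P + Ker P^(m-1)` of `Ker P^m`, for `m ≥ 1`. -/
def lowerPart (P : V →ₗ[𝕜] V) (m : ℕ) : Submodule 𝕜 V :=
  (LinearMap.ker (P ^ m) ⊓ LinearMap.range P) ⊔ LinearMap.ker (P ^ (m - 1))

/-- The dimension of the image `(L ∩ Ker P^m + W) / W` of `L ∩ Ker P^m` in the quotient by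
`W = Ker P^m ∩ Im P + Ker P^(m-1)`. -/
def topRowDim (P : V →ₗ[𝕜] V) (L : Submodule 𝕜 V) (m : ℕ) : ℕ :=
  Module.finrank 𝕜 ((L ⊓ LinearMap.ker (P ^ m)).map (lowerPart P m).mkQ)

end Jordan

end BiLagr

end

/-! With `P = B⁻¹A` self-adjoint for the symplectic form `B`, the bi-Lagrangian subspaces are the
`P`-invariant Lagrangian ones. The Lie algebra of `Aut` consists of the `B`-skew operators `X`
commuting with `P`, and `X` fixes `L` infinitesimally iff the form `B (X u) v` vanishes on `L`,
since `L` is its own orthogonal. So the orbit dimension d(L) is the dimension of the space of forms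
`B (X u) v` on `L` (`orbitDim_eq`). These are symmetric, and `P|L` is self-adjoint for them.

Upper bound. Let E be the space of forms `B (Y u) v` on `L` with `Y : L → V` commuting with `P`; its
dimension is dim Hom_P(L, V) - dim End_P(L). The forms of the tangent space are symmetric elements
of E, and the symmetric elements make up at most half of E, up to a correction: 2 d(L) ≤ dim E + dim
L (`two_mul_finrank_symm_le`). If `L` is the span of the e-vectors of a standard basis, an
equivariant projection of `V` onto `L` realizes every symmetric self-adjoint form, and
`le_two_mul_finrank_symm` turns the bound into an equality.

Comparison. Let p_k be the number of Jordan blocks of `P|L` of size greater than k, and q_k the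
number of e-chains of a standard basis of length greater than k. Then dim Hom_P(L, V) = 2 ∑ p_k q_k
and dim End_P(L) = ∑ p_k², so the bound reads 2 d(L) ≤ ∑ q_k² - ∑ (p_k - q_k)² + dim L. Hence d(L)
is strictly below the standard value unless `P|L` has the Jordan type of the e-half of a standard
basis.

Normal form. If `P|L` does have that type, then L ∩ Im P^k = P^k L for all k, and a Jordan basis of
`L` extends to a standard basis of `V` (`exists_darbouxChains`). Two standard bases differ by an
element of `Aut`, so these `L` form one orbit, the unique one of maximal dimension. The top row
condition is another way to force this Jordan type: vectors independent modulo the spaces W_j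
generate chains with independent ends, and these chains fill `L` by dimension. -/

noncomputable section

namespace BiLagr

/-! ### Jordan bases, intertwiners and kernels of powers. -/

section Jordan

open Module

variable {K : Type*} [Field K] {M N : Type*} [AddCommGroup M] [Module K M] [AddCommGroup N]
  [Module K N] {ι κ : Type*}

/-- A Jordan basis of the nilpotent operator `φ`, with blocks of sizes `μ a`: the vectors
`φ ^ k (gen a)` with `k < μ a` form a basis and `φ ^ (μ a)` kills `gen a`. -/
structure JordanBasis (φ : M →ₗ[K] M) (μ : ι → ℕ) where
  gen : ι → M
  basis : Basis (Σ a, Fin (μ a)) K M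
  basis_apply : ∀ x, basis x = (φ ^ (x.2 : ℕ)) (gen x.1)
  pow_gen : ∀ a, (φ ^ μ a) (gen a) = 0

/-- The linear maps which intertwine `φ` and `ψ`. -/
def intertwiners (φ : M →ₗ[K] M) (ψ : N →ₗ[K] N) : Submodule K (M →ₗ[K] N) where
  carrier := {Y | ∀ u, ψ (Y u) = Y (φ u)}
  zero_mem' := fun u => by simp
  add_mem' := fun {Y Z} hY hZ u => by simp [hY u, hZ u]
  smul_mem' := fun c Y hY u => by simp [hY u]

theorem intertwiners_pow {φ : M →ₗ[K] M} {ψ : N →ₗ[K] N} {Y : M →ₗ[K] N}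
    (hY : Y ∈ intertwiners φ ψ) (k : ℕ) (u : M) : (ψ ^ k) (Y u) = Y ((φ ^ k) u) := by
  induction k with
  | zero => simp
  | succ k ih => rw [pow_succ', pow_succ', Module.End.mul_apply, ih, hY, Module.End.mul_apply]

namespace JordanBasis

variable {φ : M →ₗ[K] M} {μ : ι → ℕ} (J : JordanBasis φ μ)
include J

theorem pow_gen_of_le {a : ι} {k : ℕ} (h : μ a ≤ k) : (φ ^ k) (J.gen a) = 0 := by
  obtain ⟨j, rfl⟩ := Nat.exists_eq_add_of_le h
  rw [add_comm, pow_add, Module.End.mul_apply, J.pow_gen, map_zero]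

theorem pow_gen_of_lt {a : ι} {k : ℕ} (h : k < μ a) :
    (φ ^ k) (J.gen a) = J.basis ⟨a, ⟨k, h⟩⟩ := (J.basis_apply ⟨a, ⟨k, h⟩⟩).symm

theorem pow_basis (k : ℕ) (x : Σ a, Fin (μ a)) :
    (φ ^ k) (J.basis x) = (φ ^ (k + x.2)) (J.gen x.1) := by
  rw [J.basis_apply, ← Module.End.mul_apply, pow_add]

theorem hom_ext {Y Z : M →ₗ[K] N}
    (h : ∀ a (k : ℕ), Y ((φ ^ k) (J.gen a)) = Z ((φ ^ k) (J.gen a))) : Y = Z :=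
  J.basis.ext fun x => by rw [J.basis_apply, h]

theorem form_ext {s t : LinearMap.BilinForm K M}
    (h : ∀ a c (k j : ℕ), s ((φ ^ k) (J.gen a)) ((φ ^ j) (J.gen c)) =
      t ((φ ^ k) (J.gen a)) ((φ ^ j) (J.gen c))) : s = t :=
  J.hom_ext fun a k => J.hom_ext fun c j => h a c k j

/-- The intertwiner that maps the generators of the blocks to given vectors. -/
theorem exists_intertwiner {ψ : N →ₗ[K] N} (y : ι → N) (hy : ∀ a, (ψ ^ μ a) (y a) = 0) :
    ∃ Y ∈ intertwiners φ ψ, ∀ a, Y (J.gen a) = y a := by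
  let Y : M →ₗ[K] N := J.basis.constr K fun x => (ψ ^ (x.2 : ℕ)) (y x.1)
  have hY : ∀ a k, Y ((φ ^ k) (J.gen a)) = (ψ ^ k) (y a) := by
    intro a k
    rcases lt_or_ge k (μ a) with h | h
    · rw [J.pow_gen_of_lt h, Basis.constr_basis]
    · obtain ⟨j, rfl⟩ := Nat.exists_eq_add_of_le h
      rw [J.pow_gen_of_le h, map_zero, add_comm, pow_add, Module.End.mul_apply, hy, map_zero]
  refine ⟨Y, fun u => ?_, fun a => by simpa using hY a 0⟩
  have : ψ ∘ₗ Y = Y ∘ₗ φ := J.hom_ext fun a k => by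
    simp only [LinearMap.comp_apply]
    rw [← Module.End.mul_apply φ, ← pow_succ', hY, hY, pow_succ', Module.End.mul_apply]
  exact LinearMap.congr_fun this u

/-- The images of the generators under an intertwiner. -/
def evalGen (ψ : N →ₗ[K] N) : intertwiners φ ψ →ₗ[K] (∀ a, LinearMap.ker (ψ ^ μ a)) where
  toFun := fun Y a => ⟨Y.1 (J.gen a), by
    rw [LinearMap.mem_ker, intertwiners_pow Y.2, J.pow_gen, map_zero]⟩
  map_add' := fun _ _ => rfl
  map_smul' := fun _ _ => rfl

/-- As a `K[X]`-module, `M` is the direct sum of the cyclic modules `K[X]/(X ^ μ a)`. A homomorphism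
from such a module is a free choice of an image of the generator in the kernel of `ψ ^ μ a`. -/
theorem evalGen_bijective (ψ : N →ₗ[K] N) : Function.Bijective (J.evalGen ψ) := by
  constructor
  · intro Y Z h
    refine Subtype.ext (J.hom_ext fun a k => ?_)
    rw [← intertwiners_pow Y.2, ← intertwiners_pow Z.2]
    exact congrArg _ (congrArg Subtype.val (congrFun h a))
  · intro y
    obtain ⟨Y, hY, h⟩ := J.exists_intertwiner (fun a => (y a : N)) fun a => (y a).2
    exact ⟨⟨Y, hY⟩, funext fun a => Subtype.ext (h a)⟩

theorem finrank_eq [Fintype ι] : finrank K M = ∑ a, μ a := by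
  rw [finrank_eq_card_basis J.basis, Fintype.card_sigma]
  simp

theorem finrank_intertwiners [Fintype ι] [FiniteDimensional K N] (ψ : N →ₗ[K] N) :
    finrank K (intertwiners φ ψ) = ∑ a, finrank K (LinearMap.ker (ψ ^ μ a)) := by
  rw [(LinearEquiv.ofBijective _ (J.evalGen_bijective ψ)).finrank_eq, finrank_pi_fintype]

/-- `φ ^ k` moves every chain `k` steps towards its end, so it kills the last `k` vectors of each
chain and sends the remaining basis vectors to distinct basis vectors. -/
theorem ker_pow (k : ℕ) :
    LinearMap.ker (φ ^ k) = Submodule.span K (J.basis '' {x | μ x.1 ≤ k + x.2}) := by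
  classical
  apply le_antisymm
  · intro u hu
    rw [J.basis.mem_span_image]
    intro x hx
    by_contra hlt
    have hlt : k + (x.2 : ℕ) < μ x.1 := not_le.mp hlt
    have key : ∀ v, J.basis.repr ((φ ^ k) v) ⟨x.1, ⟨k + x.2, hlt⟩⟩ = J.basis.repr v x := by
      intro v
      have : (Finsupp.lapply (⟨x.1, ⟨k + x.2, hlt⟩⟩ : Σ a, Fin (μ a))) ∘ₗ
          J.basis.repr.toLinearMap ∘ₗ (φ ^ k) =
          Finsupp.lapply x ∘ₗ J.basis.repr.toLinearMap := by
        refine J.basis.ext fun y => ?_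
        simp only [LinearMap.comp_apply, LinearEquiv.coe_coe, Finsupp.lapply_apply,
          J.pow_basis, Basis.repr_self]
        rcases lt_or_ge (k + (y.2 : ℕ)) (μ y.1) with h | h
        · rw [J.pow_gen_of_lt h, Basis.repr_self, Finsupp.single_apply, Finsupp.single_apply]
          congr 1
          obtain ⟨a, i, hi⟩ := x
          obtain ⟨c, j, hj⟩ := y
          simp only [Sigma.mk.injEq, eq_iff_iff]
          constructor
          · rintro ⟨rfl, h'⟩
            simp only [heq_eq_eq, Fin.mk.injEq] at h'
            exact ⟨rfl, by simp; omega⟩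
          · rintro ⟨rfl, h'⟩
            simp only [heq_eq_eq, Fin.mk.injEq] at h'
            exact ⟨rfl, by simp; omega⟩
        · rw [J.pow_gen_of_le h, map_zero, Finsupp.zero_apply, Finsupp.single_apply, if_neg]
          rintro rfl
          omega
      exact LinearMap.congr_fun this v
    have h1 := key u
    rw [LinearMap.mem_ker.mp hu] at h1
    simp only [map_zero, Finsupp.zero_apply] at h1
    exact (Finsupp.mem_support_iff.mp hx) h1.symm
  · rw [Submodule.span_le]
    rintro _ ⟨x, hx, rfl⟩
    rw [SetLike.mem_coe, LinearMap.mem_ker, J.pow_basis, J.pow_gen_of_le hx]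

theorem finrank_ker_pow [Fintype ι] (k : ℕ) :
    finrank K (LinearMap.ker (φ ^ k)) = ∑ a, min k (μ a) := by
  classical
  rw [J.ker_pow, Set.image_eq_range]
  refine (finrank_span_eq_card
    (J.basis.linearIndependent.comp _ Subtype.val_injective)).trans ?_
  -- Positions are counted from the end of the chain: the killed vectors are those at distance less
  -- than `k` from the end.
  let e : {x : Σ a, Fin (μ a) // μ x.1 ≤ k + x.2} ≃ Σ a, Fin (min k (μ a)) :=
    { toFun := fun x => ⟨x.1.1, ⟨μ x.1.1 - 1 - x.1.2, by
        have := x.1.2.2; have := x.2; omega⟩⟩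
      invFun := fun y => ⟨⟨y.1, ⟨μ y.1 - 1 - y.2, by have := y.2.2; omega⟩⟩, by
        have := y.2.2; dsimp only; omega⟩
      left_inv := by
        rintro ⟨⟨a, i, hi⟩, hx⟩
        simp; omega
      right_inv := by
        rintro ⟨a, i, hi⟩
        simp; omega }
  have h := Fintype.card_congr e
  rw [Fintype.card_sigma] at h
  simpa using h

/-- A Jordan basis with the blocks indexed by another type. -/
def reindex {ν : κ → ℕ} (e : ι ≃ κ) (h : ∀ a, ν (e a) = μ a) : JordanBasis φ ν where
  gen := fun c => J.gen (e.symm c)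
  basis := J.basis.reindex (Equiv.sigmaCongr e fun a => finCongr (h a).symm)
  basis_apply := by
    intro x
    obtain ⟨y, rfl⟩ := (Equiv.sigmaCongr e fun a => finCongr (h a).symm).surjective x
    rw [Basis.reindex_apply, Equiv.symm_apply_apply, J.basis_apply]
    simp only [Equiv.sigmaCongr, Equiv.trans_apply, Equiv.sigmaCongrLeft, Equiv.coe_fn_mk,
      Equiv.symm_apply_apply]
    rfl
  pow_gen := by
    intro c
    obtain ⟨a, rfl⟩ := e.surjective c
    rw [Equiv.symm_apply_apply, h, J.pow_gen]

/-- The empty blocks of a Jordan basis can be left out. -/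
def pos : JordanBasis φ (fun a : {a // 0 < μ a} => μ a) where
  gen := fun a => J.gen a
  basis := J.basis.reindex
    { toFun := fun x => ⟨⟨x.1, lt_of_le_of_lt (Nat.zero_le _) x.2.2⟩, x.2⟩
      invFun := fun y => ⟨y.1, y.2⟩
      left_inv := fun _ => rfl
      right_inv := fun _ => rfl }
  basis_apply := fun x => by
    rw [Basis.reindex_apply, J.basis_apply]
    rfl
  pow_gen := fun a => J.pow_gen a

theorem exists_pow_eq_zero [Fintype ι] : φ ^ (∑ a, μ a) = 0 := by
  refine J.hom_ext fun a k => ?_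
  rw [← Module.End.mul_apply, ← pow_add, J.pow_gen_of_le, LinearMap.zero_apply]
  exact le_add_right (Finset.single_le_sum (f := μ) (fun _ _ => Nat.zero_le _) (Finset.mem_univ a))

end JordanBasis

end Jordan

/-! ### Self-adjoint forms: how many of them are symmetric. -/

section Forms

open Module

variable {K : Type*} [Field K] {M : Type*} [AddCommGroup M] [Module K M] {ι : Type*}

instance (C : Submodule K (LinearMap.BilinForm K M)) : AddCommGroup C :=
  @Submodule.addCommGroup K (LinearMap.BilinForm K M) _ LinearMap.addCommGroup LinearMap.module C

/-- The bilinear forms with respect to which `φ` is self-adjoint. -/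
def selfAdjForms (φ : M →ₗ[K] M) : Submodule K (LinearMap.BilinForm K M) where
  carrier := {s | ∀ u v, s (φ u) v = s u (φ v)}
  zero_mem' := fun u v => by simp
  add_mem' := fun {s t} hs ht u v => by simp [hs u v, ht u v]
  smul_mem' := fun c s hs u v => by simp [hs u v]

variable (K M) in
/-- The symmetric bilinear forms. -/
def symmForms : Submodule K (LinearMap.BilinForm K M) where
  carrier := {s | ∀ u v, s u v = s v u}
  zero_mem' := fun u v => by simp
  add_mem' := fun {s t} hs ht u v => by simp [hs u v, ht u v]
  smul_mem' := fun c s hs u v => by simp [hs u v]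

variable (K M) in
/-- The skew-symmetric bilinear forms. -/
def skewForms : Submodule K (LinearMap.BilinForm K M) where
  carrier := {s | ∀ u v, s u v = -s v u}
  zero_mem' := fun u v => by simp
  add_mem' := fun {s t} hs ht u v => by
    simp only [LinearMap.add_apply, hs u v, ht u v]; ring
  smul_mem' := fun c s hs u v => by simp [hs u v]

theorem mem_symmForms {s : LinearMap.BilinForm K M} : s ∈ symmForms K M ↔ ∀ u v, s u v = s v u :=
  Iff.rfl

theorem selfAdjForms_pow {φ : M →ₗ[K] M} {s : LinearMap.BilinForm K M}
    (hs : s ∈ selfAdjForms φ) (k : ℕ)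
    (u v : M) : s ((φ ^ k) u) v = s u ((φ ^ k) v) := by
  induction k generalizing u with
  | zero => simp
  | succ k ih =>
    rw [pow_succ, Module.End.mul_apply, ih, hs, ← pow_succ, pow_succ', Module.End.mul_apply]

/-- The map `s ↦ s (θ u) v - s u (θ v)` on bilinear forms. -/
def formCommutator (θ : M →ₗ[K] M) : LinearMap.BilinForm K M →ₗ[K] LinearMap.BilinForm K M where
  toFun s := s ∘ₗ θ - LinearMap.flip (LinearMap.flip s ∘ₗ θ)
  map_add' s t := by
    ext u v
    simp only [LinearMap.add_apply, LinearMap.sub_apply, LinearMap.comp_apply,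
      LinearMap.flip_apply]
    ring
  map_smul' c s := by
    ext u v
    simp only [LinearMap.smul_apply, LinearMap.sub_apply, LinearMap.comp_apply,
      LinearMap.flip_apply, RingHom.id_apply, smul_eq_mul]
    ring

theorem formCommutator_apply (θ : M →ₗ[K] M) (s : LinearMap.BilinForm K M) (u v : M) :
    formCommutator θ s u v = s (θ u) v - s u (θ v) := rfl

variable (K M) in
/-- The map `s ↦ s u v - s v u` on bilinear forms. -/
def antisymmetrization : LinearMap.BilinForm K M →ₗ[K] LinearMap.BilinForm K M :=
  { toFun s := s - LinearMap.flip s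
    map_add' s t := by
      ext u v
      simp only [LinearMap.add_apply, LinearMap.sub_apply, LinearMap.flip_apply]
      ring
    map_smul' c s := by
      ext u v
      simp only [LinearMap.smul_apply, LinearMap.sub_apply, LinearMap.flip_apply,
        RingHom.id_apply, smul_eq_mul]
      ring }

theorem antisymmetrization_apply (s : LinearMap.BilinForm K M) (u v : M) :
    antisymmetrization K M s u v = s u v - s v u := rfl

theorem ker_antisymmetrization : LinearMap.ker (antisymmetrization K M) = symmForms K M := by
  ext s
  rw [LinearMap.mem_ker, mem_symmForms]
  constructor
  · intro h u v
    have := LinearMap.congr_fun₂ h u v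
    rw [antisymmetrization_apply] at this
    exact sub_eq_zero.mp this
  · intro h
    ext u v
    rw [antisymmetrization_apply, h u v, sub_self]
    rfl

theorem finrank_range_antisymmetrization_add [FiniteDimensional K M]
    (E : Submodule K (LinearMap.BilinForm K M)) :
    finrank K (LinearMap.range ((antisymmetrization K M).domRestrict E)) +
      finrank K (E ⊓ symmForms K M : Submodule K (LinearMap.BilinForm K M)) = finrank K E := by
  have : LinearMap.ker ((antisymmetrization K M).domRestrict E) =
      (E ⊓ symmForms K M).comap E.subtype := by
    ext s
    rw [Submodule.mem_comap, Submodule.mem_inf, ← ker_antisymmetrization]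
    simp
  have h := LinearMap.finrank_range_add_finrank_ker (K := K) (V := E)
    (V₂ := LinearMap.BilinForm K M) ((antisymmetrization K M).domRestrict E)
  rw [this] at h
  have h' : finrank K ((E ⊓ symmForms K M).comap E.subtype) =
      finrank K (E ⊓ symmForms K M : Submodule K (LinearMap.BilinForm K M)) :=
    LinearEquiv.finrank_eq (Submodule.comapSubtypeEquivOfLe inf_le_left)
  rw [← h, ← h']

namespace JordanBasis

variable {φ : M →ₗ[K] M} {μ : ι → ℕ} (J : JordanBasis φ μ)
include J

/-- The operator that acts on the Jordan block of index `a` as the scalar `c a`. -/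
def blockScalar (c : ι → K) : M →ₗ[K] M := J.basis.constr K fun x => c x.1 • J.basis x

theorem blockScalar_pow_gen (c : ι → K) (a : ι) (k : ℕ) :
    J.blockScalar c ((φ ^ k) (J.gen a)) = c a • (φ ^ k) (J.gen a) := by
  rcases lt_or_ge k (μ a) with h | h
  · rw [J.pow_gen_of_lt h, blockScalar, Basis.constr_basis]
  · rw [J.pow_gen_of_le h, map_zero, smul_zero]

theorem blockScalar_mem (c : ι → K) : J.blockScalar c ∈ intertwiners φ φ := by
  have : φ ∘ₗ J.blockScalar c = J.blockScalar c ∘ₗ φ := J.hom_ext fun a k => by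
    simp only [LinearMap.comp_apply]
    rw [blockScalar_pow_gen, map_smul, ← Module.End.mul_apply φ, ← pow_succ', blockScalar_pow_gen]
  exact LinearMap.congr_fun this

/-- For pairwise distinct scalars the commutator kills exactly the block-diagonal part of a form and
is invertible off the diagonal. It also exchanges symmetric and skew forms, which allows their
dimensions to be compared. -/
theorem formCommutator_blockScalar (c : ι → K) (s : LinearMap.BilinForm K M) (a b : ι) (k j : ℕ) :
    formCommutator (J.blockScalar c) s ((φ ^ k) (J.gen a)) ((φ ^ j) (J.gen b)) =
      (c a - c b) * s ((φ ^ k) (J.gen a)) ((φ ^ j) (J.gen b)) := by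
  rw [formCommutator_apply, blockScalar_pow_gen, blockScalar_pow_gen]
  simp only [map_smul, LinearMap.smul_apply, smul_eq_mul]
  ring

/-- The self-adjoint form which is block-diagonal and is given by a functional. -/
def diagForm [DecidableEq ι] : Module.Dual K M →ₗ[K] LinearMap.BilinForm K M where
  toFun l := J.basis.constr K fun x => J.basis.constr K fun y =>
    if x.1 = y.1 then l ((φ ^ (x.2 + y.2 : ℕ)) (J.gen x.1)) else 0
  map_add' l m := J.basis.ext fun x => J.basis.ext fun y => by
    simp only [LinearMap.add_apply, Basis.constr_basis]
    split_ifs <;> simp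
  map_smul' r l := J.basis.ext fun x => J.basis.ext fun y => by
    simp only [LinearMap.smul_apply, Basis.constr_basis, RingHom.id_apply]
    split_ifs <;> simp

theorem diagForm_apply [DecidableEq ι] (l : Module.Dual K M) (a b : ι) (k j : ℕ) :
    J.diagForm l ((φ ^ k) (J.gen a)) ((φ ^ j) (J.gen b)) =
      if a = b then l ((φ ^ (k + j)) (J.gen a)) else 0 := by
  rcases lt_or_ge k (μ a) with h | h
  · rcases lt_or_ge j (μ b) with h' | h'
    · rw [J.pow_gen_of_lt h, J.pow_gen_of_lt h']
      simp [diagForm, Basis.constr_basis]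
    · rw [J.pow_gen_of_le h', map_zero]
      split_ifs with e
      · subst e
        rw [J.pow_gen_of_le (by omega), map_zero]
      · rfl
  · rw [J.pow_gen_of_le h, map_zero, LinearMap.zero_apply, J.pow_gen_of_le (by omega), map_zero]
    simp

theorem diagForm_mem [DecidableEq ι] (l : Module.Dual K M) :
    J.diagForm l ∈ selfAdjForms φ ⊓ symmForms K M := by
  constructor
  · have : J.diagForm l ∘ₗ φ = LinearMap.flip (LinearMap.flip (J.diagForm l) ∘ₗ φ) := by
      refine J.form_ext fun a b k j => ?_
      simp only [LinearMap.comp_apply, LinearMap.flip_apply]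
      rw [← Module.End.mul_apply φ, ← Module.End.mul_apply φ, ← pow_succ', ← pow_succ',
        diagForm_apply, diagForm_apply, add_right_comm, add_assoc]
    exact LinearMap.congr_fun₂ this
  · have : J.diagForm l = LinearMap.flip (J.diagForm l) := by
      refine J.form_ext fun a b k j => ?_
      rw [LinearMap.flip_apply, diagForm_apply, diagForm_apply, add_comm]
      by_cases e : a = b
      · subst e; simp
      · rw [if_neg e, if_neg (Ne.symm e)]
    exact LinearMap.congr_fun₂ this

variable [Fintype ι] [FiniteDimensional K M] [CharZero K]

/-- A space of self-adjoint forms which is stable under the intertwiners acting on the first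
variable contains few symmetric forms. -/
theorem two_mul_finrank_symm_le (E : Submodule K (LinearMap.BilinForm K M))
    (hE : E ≤ selfAdjForms φ)
    (hstab : ∀ θ ∈ intertwiners φ φ, ∀ s ∈ E, s ∘ₗ θ ∈ E) :
    2 * finrank K (E ⊓ symmForms K M : Submodule K (LinearMap.BilinForm K M)) ≤
      finrank K E + finrank K M := by
  classical
  -- Pairwise distinct scalars, available in characteristic zero.
  let c : ι → K := fun a => ((Fintype.equivFin ι a : ℕ) : K)
  have hc : ∀ a b, c a = c b → a = b := fun a b h =>
    (Fintype.equivFin ι).injective (Fin.ext (Nat.cast_injective h))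
  set S : Submodule K (LinearMap.BilinForm K M) := E ⊓ symmForms K M with hS
  let T := (formCommutator (J.blockScalar c)).domRestrict S
  let A := (antisymmetrization K M).domRestrict E
  have h1 : finrank K (LinearMap.range A) + finrank K S = finrank K E :=
    finrank_range_antisymmetrization_add _
  -- For symmetric `s`, the commutator with θ is the antisymmetrization of `s ∘ₗ θ`, which lies in
  -- `E` by stability. The range of `A` has dimension dim E - dim S.
  have h2 : LinearMap.range T ≤ LinearMap.range A := by
    rintro _ ⟨s, rfl⟩
    refine ⟨⟨_, hstab _ (J.blockScalar_mem c) s.1 s.2.1⟩, ?_⟩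
    ext u v
    simp only [A, T, LinearMap.domRestrict_apply]
    rw [antisymmetrization_apply, formCommutator_apply, LinearMap.comp_apply,
      LinearMap.comp_apply, s.2.2 (J.blockScalar c v) u]
  -- A form in the kernel is block-diagonal. By self-adjointness, its block at `a` is determined by
  -- the values at `(φ ^ k (gen a), gen a)`, one for each vector of the Jordan basis.
  have h3 : finrank K (LinearMap.ker T) ≤ finrank K M := by
    let D : LinearMap.ker T →ₗ[K] ((Σ a, Fin (μ a)) → K) :=
      { toFun := fun s x => s.1.1 (J.basis x) (J.gen x.1)
        map_add' := fun s t => rfl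
        map_smul' := fun r s => rfl }
    have hD : Function.Injective D := by
      rw [injective_iff_map_eq_zero]
      intro s hs
      refine Subtype.ext (Subtype.ext (J.form_ext fun a b k j => ?_))
      have hk := LinearMap.congr_fun₂ (LinearMap.mem_ker.mp s.2) ((φ ^ k) (J.gen a))
        ((φ ^ j) (J.gen b))
      rw [LinearMap.domRestrict_apply, formCommutator_blockScalar] at hk
      rcases mul_eq_zero.mp hk with h | h
      · obtain rfl := hc a b (sub_eq_zero.mp h)
        rw [← selfAdjForms_pow (hE s.1.2.1), ← Module.End.mul_apply, ← pow_add]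
        rcases lt_or_ge (j + k) (μ a) with h | h
        · rw [J.pow_gen_of_lt h]
          exact congrFun hs ⟨a, ⟨j + k, h⟩⟩
        · rw [J.pow_gen_of_le h, map_zero]
          rfl
      · exact h
    have := LinearMap.finrank_le_finrank_of_injective hD
    rwa [finrank_fintype_fun_eq_card, ← finrank_eq_card_basis J.basis] at this
  have h4 := LinearMap.finrank_range_add_finrank_ker (K := K) (V := S)
    (V₂ := LinearMap.BilinForm K M) T
  have h5 := Submodule.finrank_mono h2
  omega

/-- There are sufficiently many symmetric forms for which a given operator is self-adjoint. -/
theorem le_two_mul_finrank_symm :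
    finrank K (selfAdjForms φ) + finrank K M ≤
      2 * finrank K (selfAdjForms φ ⊓ symmForms K M : Submodule K (LinearMap.BilinForm K M)) := by
  classical
  let c : ι → K := fun a => ((Fintype.equivFin ι a : ℕ) : K)
  have hc : ∀ a b, c a = c b → a = b := fun a b h =>
    (Fintype.equivFin ι).injective (Fin.ext (Nat.cast_injective h))
  set S : Submodule K (LinearMap.BilinForm K M) := selfAdjForms φ ⊓ symmForms K M with hS
  set C : Submodule K (LinearMap.BilinForm K M) := selfAdjForms φ ⊓ skewForms K M with hC
  let A := (antisymmetrization K M).domRestrict (selfAdjForms φ)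
  have h1 : finrank K (LinearMap.range A) + finrank K S = finrank K (selfAdjForms φ) :=
    finrank_range_antisymmetrization_add _
  have h2 : LinearMap.range A ≤ C := by
    rintro _ ⟨s, rfl⟩
    refine ⟨fun u v => ?_, fun u v => ?_⟩
    · simp only [A, LinearMap.domRestrict_apply, antisymmetrization_apply]
      rw [s.2 u v, ← s.2 v u]
    · simp only [A, LinearMap.domRestrict_apply, antisymmetrization_apply]
      ring
  let θ := J.blockScalar c
  have hθ : ∀ u, φ (θ u) = θ (φ u) := J.blockScalar_mem c
  -- Symmetric forms are built from skew ones off the diagonal and from functionals on the diagonal.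
  -- Injectivity gives dim C + dim M ≤ dim S, while dim C is at least the dimension of the range of
  -- `A`.
  let F : C × Module.Dual K M →ₗ[K] LinearMap.BilinForm K M :=
    ((formCommutator θ).domRestrict C).coprod J.diagForm
  have hF : ∀ x, F x ∈ S := by
    rintro ⟨s, l⟩
    refine Submodule.add_mem _ ⟨fun u v => ?_, fun u v => ?_⟩ (J.diagForm_mem l)
    · change formCommutator θ s.1 (φ u) v = formCommutator θ s.1 u (φ v)
      rw [formCommutator_apply, formCommutator_apply, ← hθ, s.2.1, s.2.1, hθ]
    · change formCommutator θ s.1 u v = formCommutator θ s.1 v u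
      rw [formCommutator_apply, formCommutator_apply, s.2.2 (θ u) v, s.2.2 u (θ v)]
      ring
  have hFinj : Function.Injective (F.codRestrict S hF) := by
    rw [injective_iff_map_eq_zero]
    rintro ⟨s, l⟩ h
    have h0 : ∀ a b k j, (c a - c b) * s.1 ((φ ^ k) (J.gen a)) ((φ ^ j) (J.gen b)) +
        (if a = b then l ((φ ^ (k + j)) (J.gen a)) else 0) = 0 := by
      intro a b k j
      rw [← J.formCommutator_blockScalar, ← J.diagForm_apply]
      exact LinearMap.congr_fun₂ (congrArg Subtype.val h) _ _
    have hl : l = 0 := J.hom_ext fun a k => by simpa using h0 a a k 0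
    refine Prod.ext (Subtype.ext (J.form_ext fun a b k j => ?_)) hl
    by_cases e : a = b
    · subst e
      -- On a single cyclic block a self-adjoint form is symmetric, so a skew one vanishes there.
      have hpow : ∀ i, s.1 ((φ ^ i) (J.gen a)) (J.gen a) = 0 := by
        intro i
        have h' := selfAdjForms_pow s.2.1 i (J.gen a) (J.gen a)
        rw [s.2.2 (J.gen a)] at h'
        exact self_eq_neg.mp h'
      change s.1 _ _ = 0
      rw [← selfAdjForms_pow s.2.1, ← Module.End.mul_apply, ← pow_add, hpow]
    · have := h0 a b k j
      rw [if_neg e, add_zero] at this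
      exact (mul_eq_zero.mp this).resolve_left fun h => e (hc a b (sub_eq_zero.mp h))
  have h3 := LinearMap.finrank_le_finrank_of_injective hFinj
  rw [finrank_prod, Subspace.dual_finrank_eq] at h3
  have h4 := Submodule.finrank_mono h2
  omega

end JordanBasis

end Forms

/-! ### An inequality between two partitions. -/

section Combinatorics

open Finset

variable {ι κ : Type*} [Fintype ι] [Fintype κ]

theorem min_eq_sum_range {N p q : ℕ} (hp : p ≤ N) :
    min p q = ∑ k ∈ range N, (if k < p then 1 else 0) * (if k < q then 1 else 0) := by
  have : ∀ k, (if k < p then 1 else 0) * (if k < q then 1 else 0) =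
      if k < min p q then 1 else 0 := by
    intro k
    by_cases h1 : k < p <;> by_cases h2 : k < q <;> simp [h1, h2]
  simp_rw [this]
  rw [sum_boole, Nat.cast_id]
  conv_lhs => rw [← card_range (min p q)]
  congr 1
  ext k
  simp only [mem_range, mem_filter]
  omega

/-- `min p q` counts the `k` below both `p` and `q`; summing over `k` last gives the scalar product
of the conjugate partitions. -/
theorem sum_min_eq {N : ℕ} (μ : ι → ℕ) (ν : κ → ℕ) (hμ : ∀ a, μ a ≤ N) :
    ∑ a, ∑ b, min (μ a) (ν b) =
      ∑ k ∈ range N, (#{a | k < μ a}) * #{b | k < ν b} := by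
  simp_rw [min_eq_sum_range (hμ _), card_filter]
  rw [sum_congr rfl fun a _ => sum_comm, sum_comm]
  refine sum_congr rfl fun k _ => ?_
  rw [sum_mul_sum]

theorem card_filter_lt_eq (f : ι → ℕ) (n : ℕ) :
    #{a | n < f a} = #{a | f a = n + 1} + #{a | n + 1 < f a} := by
  classical
  rw [← card_union_of_disjoint]
  · congr 1
    ext a
    simp only [mem_filter, mem_univ, true_and, mem_union]
    omega
  · rw [disjoint_left]
    intro a
    simp only [mem_filter, mem_univ, true_and]
    omega

/-- The multiplicity of a part is a difference of two consecutive terms of the conjugate partition.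
Positivity is needed because these counts do not see zero parts. -/
theorem exists_equiv_of_card_lt_eq (μ : ι → ℕ) (ν : κ → ℕ) (hμ : ∀ a, 0 < μ a)
    (hν : ∀ b, 0 < ν b) (h : ∀ k, #{a | k < μ a} = #{b | k < ν b}) :
    ∃ e : ι ≃ κ, ∀ a, ν (e a) = μ a := by
  classical
  have hcard : ∀ n, #{a | μ a = n} = #{b | ν b = n} := by
    intro n
    rcases n with _ | n
    · rw [filter_eq_empty_iff.mpr fun a _ => (hμ a).ne', filter_eq_empty_iff.mpr
        fun a _ => (hν a).ne']
      rfl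
    · have h1 := card_filter_lt_eq μ n
      have h2 := card_filter_lt_eq ν n
      have h3 := h n
      have h4 := h (n + 1)
      omega
  have hfib : ∀ n, Nonempty ({a // μ a = n} ≃ {b // ν b = n}) := fun n => by
    refine ⟨Fintype.equivOfCardEq ?_⟩
    rw [Fintype.card_subtype, Fintype.card_subtype, hcard n]
  let e : ι ≃ κ := (Equiv.sigmaFiberEquiv μ).symm.trans
    ((Equiv.sigmaCongrRight fun n => (hfib n).some).trans (Equiv.sigmaFiberEquiv ν))
  exact ⟨e, fun a => ((hfib (μ a)).some ⟨a, rfl⟩).2⟩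

/-- In terms of the conjugate partitions p and q, the right side minus the left side is ∑ (p_k -
q_k)². It is zero only if p = q, and then the partitions agree. -/
theorem two_mul_sum_min_lt_or_exists_equiv (μ : ι → ℕ) (ν : κ → ℕ) (hμ : ∀ a, 0 < μ a)
    (hν : ∀ b, 0 < ν b) :
    2 * ∑ a, ∑ b, min (μ a) (ν b) <
        ∑ a, ∑ b, min (μ a) (μ b) + ∑ a, ∑ b, min (ν a) (ν b) ∨
      ∃ e : ι ≃ κ, ∀ a, ν (e a) = μ a := by
  set N := ∑ a, μ a + ∑ b, ν b
  have h1 : ∀ a, μ a ≤ N := fun a =>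
    le_add_right (single_le_sum (f := μ) (fun _ _ => Nat.zero_le _) (mem_univ a))
  have h2 : ∀ b, ν b ≤ N := fun b =>
    le_add_left (single_le_sum (f := ν) (fun _ _ => Nat.zero_le _) (mem_univ b))
  by_cases h : ∀ k, #{a | k < μ a} = #{b | k < ν b}
  · exact Or.inr (exists_equiv_of_card_lt_eq μ ν hμ hν h)
  · left
    rw [sum_min_eq μ ν h1, sum_min_eq μ μ h1, sum_min_eq ν ν h2, mul_sum, ← sum_add_distrib]
    push Not at h
    obtain ⟨k, hk⟩ := h
    have key : ∀ p q : ℕ, 2 * (p * q) ≤ p * p + q * q := fun p q => by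
      zify; nlinarith [sq_nonneg ((p : ℤ) - q)]
    refine sum_lt_sum (fun k _ => key _ _) ⟨k, ?_, ?_⟩
    · rw [mem_range]
      by_contra hkN
      apply hk
      rw [filter_eq_empty_iff.mpr fun a _ => by have := h1 a; omega,
        filter_eq_empty_iff.mpr fun b _ => by have := h2 b; omega]
      rfl
    · rcases lt_or_gt_of_ne hk with h | h <;> nlinarith

end Combinatorics

/-! ### Existence of Jordan bases. -/

section Chains

open Module

variable {K : Type*} [Field K] {M : Type*} [AddCommGroup M] [Module K M] {ι : Type*}

/-- Vectors whose chains under `φ` end in linearly independent vectors have linearly independent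
chains. -/
theorem linearIndependent_chains [Finite ι] (φ : M →ₗ[K] M) (μ : ι → ℕ) (g : ι → M)
    (hg : ∀ a, (φ ^ μ a) (g a) = 0)
    (hli : LinearIndependent K fun a : {a // 0 < μ a} => (φ ^ (μ a - 1)) (g a)) :
    LinearIndependent K fun x : Σ a, Fin (μ a) => (φ ^ (x.2 : ℕ)) (g x.1) := by
  have := Fintype.ofFinite ι
  rw [Fintype.linearIndependent_iff] at hli ⊢
  intro c hc
  have hzero : ∀ a k, μ a ≤ k → (φ ^ k) (g a) = 0 := by
    intro a k h
    obtain ⟨j, rfl⟩ := Nat.exists_eq_add_of_le h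
    rw [add_comm, pow_add, Module.End.mul_apply, hg, map_zero]
  -- Here `r` is the distance to the end of the chain. If the coefficients at larger distances
  -- vanish, `φ ^ r` turns the relation into one between chain ends whose coefficients are those at
  -- distance `r`.
  have key : ∀ r, ∀ x : Σ a, Fin (μ a), (∀ y : Σ a, Fin (μ a), r < μ y.1 - 1 - y.2 → c y = 0) →
      μ x.1 - 1 - x.2 = r → c x = 0 := by
    intro r x hr hx
    have h1 := congrArg (φ ^ r) hc
    rw [map_sum, map_zero, Fintype.sum_sigma] at h1
    let d : {a // 0 < μ a} → K := fun a =>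
      if h : r < μ a then c ⟨a, ⟨μ a - 1 - r, by omega⟩⟩ else 0
    have h2 : ∑ a, d a • (φ ^ (μ a - 1)) (g a) = 0 := by
      rw [← h1]
      have h3 : ∀ a, 0 < μ a ∨ ∑ k : Fin (μ a), (φ ^ r) (c ⟨a, k⟩ • (φ ^ (k : ℕ)) (g a)) = 0 := by
        intro a
        rcases Nat.eq_zero_or_pos (μ a) with h | h
        · right
          refine Finset.sum_eq_zero fun k _ => ?_
          have := k.2
          omega
        · exact Or.inl h
      rw [← Finset.sum_subtype_of_mem (p := fun a => 0 < μ a)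
        (s := Finset.univ.filter fun a => 0 < μ a)
        (f := fun a => ∑ k : Fin (μ a), (φ ^ r) (c ⟨a, k⟩ • (φ ^ (k : ℕ)) (g a)))
        (fun a ha => (Finset.mem_filter.mp ha).2) |>.trans (Finset.sum_filter_of_ne fun a _ h =>
          (h3 a).resolve_right h)]
      refine Finset.sum_congr (by ext a; simp [a.2]) fun a _ => ?_
      simp only [map_smul, ← Module.End.mul_apply, ← pow_add]
      by_cases h : r < μ a
      · rw [Finset.sum_eq_single ⟨μ a - 1 - r, by omega⟩]
        · simp only [d, dif_pos h]
          rw [show r + (μ a - 1 - r) = μ a - 1 by omega]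
        · intro k _ hk
          have hk' : (k : ℕ) ≠ μ a - 1 - r := fun e => hk (Fin.ext e)
          rcases lt_or_gt_of_ne hk' with hlt | hgt
          · rw [hr ⟨a, k⟩ (by dsimp only; omega), zero_smul]
          · rw [hzero _ _ (by omega), smul_zero]
        · simp
      · simp only [d, dif_neg h, zero_smul]
        refine (Finset.sum_eq_zero fun k _ => ?_).symm
        rw [hzero _ _ (by omega), smul_zero]
    have h4 := hli d h2 ⟨x.1, lt_of_le_of_lt (Nat.zero_le _) x.2.2⟩
    have h5 := x.2.2
    have h6 : r < μ x.1 := by omega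
    simp only [d, dif_pos h6] at h4
    rw [← h4]
    congr 1
    exact Sigma.ext rfl (heq_of_eq (Fin.ext (by simp only; omega)))
  -- Descending induction on the distance `r`, which starts above the length of every chain; `j`
  -- bounds the number of steps left.
  have hall : ∀ j r, (∑ a, μ a) ≤ r + j → ∀ x : Σ a, Fin (μ a), r ≤ μ x.1 - 1 - x.2 → c x = 0 := by
    intro j
    induction j with
    | zero =>
      intro r h x hx
      have h1 : μ x.1 ≤ ∑ a, μ a :=
        Finset.single_le_sum (f := μ) (fun _ _ => Nat.zero_le _) (Finset.mem_univ x.1)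
      have := x.2.2
      omega
    | succ j ih =>
      intro r h x hx
      rcases hx.eq_or_lt with e | hlt
      · exact key r x (fun y hy => ih (r + 1) (by omega) y hy) e.symm
      · exact ih (r + 1) (by omega) x hlt
  exact fun x => hall (∑ a, μ a) 0 (by omega) x (Nat.zero_le _)

/-- Chains that end in linearly independent vectors and are long enough form a Jordan basis. -/
theorem exists_jordanBasis_of_linearIndependent [Fintype ι] [FiniteDimensional K M]
    (φ : M →ₗ[K] M) (μ : ι → ℕ) (g : ι → M) (hg : ∀ a, (φ ^ μ a) (g a) = 0)
    (hli : LinearIndependent K fun a : {a // 0 < μ a} => (φ ^ (μ a - 1)) (g a))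
    (hcard : ∑ a, μ a = finrank K M) : ∃ J : JordanBasis φ μ, J.gen = g := by
  have h := linearIndependent_chains φ μ g hg hli
  have hc : Fintype.card (Σ a, Fin (μ a)) = finrank K M := by
    rw [Fintype.card_sigma, ← hcard]
    simp
  rcases isEmpty_or_nonempty (Σ a, Fin (μ a)) with he | he
  · have : Subsingleton M := by
      rw [Fintype.card_eq_zero] at hc
      exact finrank_zero_iff.mp hc.symm
    exact ⟨⟨g, Basis.empty M, fun x => (IsEmpty.false x).elim, hg⟩, rfl⟩
  · exact ⟨⟨g, basisOfLinearIndependentOfCardEqFinrank h hc, fun x => by simp, hg⟩, rfl⟩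

theorem dfinsuppBasis_apply [DecidableEq ι] {η : ι → Type*} {W : ι → Type*}
    [∀ i, AddCommGroup (W i)] [∀ i, Module K (W i)] (b : ∀ i, Basis (η i) K (W i))
    (x : Σ i, η i) : DFinsupp.basis b x = DFinsupp.single x.1 (b x.1 x.2) := by
  have h : sigmaFinsuppLequivDFinsupp (N := K) K (Finsupp.single x 1) =
      DFinsupp.single x.1 (Finsupp.single x.2 1) := sigmaFinsuppEquivDFinsupp_single x 1
  rw [DFinsupp.basis, Basis.coe_ofRepr]
  simp only [LinearEquiv.trans_symm, LinearEquiv.symm_symm, LinearEquiv.trans_apply, h]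
  rw [LinearEquiv.symm_apply_eq, DFinsupp.mapRange.linearEquiv_apply, DFinsupp.mapRange_single,
    Basis.repr_self]

variable (K) in
theorem exists_basis_adjoinRoot_X_pow (n : ℕ) :
    ∃ b : Basis (Fin n) K (AdjoinRoot ((Polynomial.X : Polynomial K) ^ n)),
      ∀ k, b k = AdjoinRoot.mk _ (Polynomial.X ^ (k : ℕ)) := by
  refine ⟨(AdjoinRoot.powerBasis' (Polynomial.monic_X_pow (R := K) n)).basis.reindex
      (finCongr (by simp)), fun k => ?_⟩
  rw [Basis.reindex_apply, PowerBasis.basis_eq_pow, map_pow]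
  rfl

variable (K) in
theorem exists_basis_quotient_X_pow (n : ℕ) :
    ∃ b : Basis (Fin n) K (Polynomial K ⧸
        (Submodule.span (Polynomial K) {(Polynomial.X : Polynomial K) ^ n})),
      ∀ k, b k = Submodule.Quotient.mk (Polynomial.X ^ (k : ℕ)) :=
  exists_basis_adjoinRoot_X_pow K n

/-- Every nilpotent operator has a Jordan basis. -/
theorem exists_jordanBasis [FiniteDimensional K M] (φ : M →ₗ[K] M) {N : ℕ} (hφ : φ ^ N = 0) :
    ∃ (d : ℕ) (μ : Fin d → ℕ), Nonempty (JordanBasis φ μ) := by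
  let W := AEval' φ
  -- Nilpotency makes `M` an `X`-primary torsion module over `K[X]`. The structure theorem then
  -- splits it into modules `K[X]/(X ^ μ i)`, whose monomial bases are the Jordan chains; some `μ i`
  -- may be zero.
  have htors : Module.IsTorsion' W (Submonoid.powers (Polynomial.X : Polynomial K)) := by
    intro w
    obtain ⟨m, rfl⟩ := (AEval'.of φ).surjective w
    refine ⟨⟨Polynomial.X ^ N, N, rfl⟩, ?_⟩
    change (Polynomial.X ^ N : Polynomial K) • (AEval'.of φ m) = 0
    rw [AEval'.X_pow_smul_of, hφ]
    simp
  obtain ⟨d, μ, ⟨e⟩⟩ := Module.torsion_by_prime_power_decomposition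
    (p := (Polynomial.X : Polynomial K)) Polynomial.irreducible_X htors
  refine ⟨d, μ, ⟨?_⟩⟩
  choose b0 hb0 using fun i => exists_basis_quotient_X_pow K (μ i)
  let b1 : Basis (Σ i, Fin (μ i)) K (DirectSum (Fin d) fun i =>
      Polynomial K ⧸ (Submodule.span (Polynomial K) {(Polynomial.X : Polynomial K) ^ μ i})) :=
    DFinsupp.basis b0
  let e' := (AEval'.of φ).trans (e.restrictScalars K)
  let g0 : ∀ i, DirectSum (Fin d) fun i =>
      Polynomial K ⧸ (Submodule.span (Polynomial K) {(Polynomial.X : Polynomial K) ^ μ i}) :=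
    fun i => DirectSum.lof (Polynomial K) (Fin d) (fun i =>
      Polynomial K ⧸ (Submodule.span (Polynomial K) {(Polynomial.X : Polynomial K) ^ μ i})) i
      (Submodule.Quotient.mk 1)
  have hpow : ∀ k v, e'.symm ((Polynomial.X : Polynomial K) ^ k • v) = (φ ^ k) (e'.symm v) := by
    intro k v
    apply e'.injective
    rw [LinearEquiv.apply_symm_apply]
    obtain ⟨m, rfl⟩ := e'.surjective v
    rw [LinearEquiv.symm_apply_apply]
    change _ = e (AEval'.of φ ((φ ^ k) m))
    have := AEval'.X_pow_smul_of φ m k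
    rw [Module.End.smul_def] at this
    rw [← this, map_smul]
    rfl
  have hb1 : ∀ x, b1 x = (Polynomial.X : Polynomial K) ^ (x.2 : ℕ) • g0 x.1 := by
    intro x
    have h0 : b0 x.1 x.2 = (Polynomial.X : Polynomial K) ^ (x.2 : ℕ) •
        (Submodule.Quotient.mk 1 : Polynomial K ⧸
          (Submodule.span (Polynomial K) {(Polynomial.X : Polynomial K) ^ μ x.1})) := by
      rw [hb0, ← Submodule.Quotient.mk_smul, smul_eq_mul, mul_one]
    simp only [b1, g0]
    rw [← map_smul, ← h0]
    exact dfinsuppBasis_apply b0 x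
  exact
    { gen := fun i => e'.symm (g0 i)
      basis := b1.map e'.symm
      basis_apply := fun x => by rw [Basis.map_apply, hb1, hpow]
      pow_gen := fun i => by
        rw [← hpow]
        simp only [g0]
        rw [← map_smul, ← Submodule.Quotient.mk_smul, smul_eq_mul, mul_one,
          (Submodule.Quotient.mk_eq_zero _).mpr (Submodule.mem_span_singleton_self _), map_zero,
          map_zero] }

end Chains

/-! ### The Lie algebras of the automorphism group and of a stabilizer. -/

section LieAlgebra

open Module

variable {𝕜 : Type*} [RCLike 𝕜] {V : Type*} [AddCommGroup V] [Module 𝕜 V]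

theorem mem_Aut_iff {A B : LinearMap.BilinForm 𝕜 V} {g : V ≃ₗ[𝕜] V} :
    g ∈ Aut A B ↔ (∀ u v, A (g u) (g v) = A u v) ∧ ∀ u v, B (g u) (g v) = B u v := by
  constructor
  · intro h
    have hB : ∀ u v, B (g u) (g v) = B u v := h none
    refine ⟨fun u v => ?_, hB⟩
    have h0 := h (some 0) u v
    simpa [pencilForm] using h0
  · rintro ⟨hA, hB⟩ (_ | c) u v
    · exact hB u v
    · simp [pencilForm, hA u v, hB u v]

/-- The operators that are infinitesimal automorphisms of both forms. -/
def infAut (A B : LinearMap.BilinForm 𝕜 V) : Submodule 𝕜 (V →ₗ[𝕜] V) where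
  carrier := {X | (∀ u v, A (X u) v = -A u (X v)) ∧ ∀ u v, B (X u) v = -B u (X v)}
  zero_mem' := by simp
  add_mem' := by
    rintro X Y ⟨hA, hB⟩ ⟨hA', hB'⟩
    constructor
    · intro u v
      simp only [LinearMap.add_apply, map_add, hA u v, hA' u v]
      ring
    · intro u v
      simp only [LinearMap.add_apply, map_add, hB u v, hB' u v]
      ring
  smul_mem' := by
    rintro c X ⟨hA, hB⟩
    exact ⟨fun u v => by simp [hA u v], fun u v => by simp [hB u v]⟩

variable (𝕜) in
/-- The operators that map the subspace `L` into itself. -/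
def preserving (L : Submodule 𝕜 V) : Subalgebra 𝕜 (V →ₗ[𝕜] V) where
  carrier := {X | ∀ u ∈ L, X u ∈ L}
  mul_mem' := fun hX hY u hu => hX _ (hY u hu)
  add_mem' := fun hX hY u hu => L.add_mem (hX u hu) (hY u hu)
  algebraMap_mem' := fun c _ hu => L.smul_mem c hu

section Exponential

/-- The analysis is done in a normed algebra. Matrices have no canonical norm, so an operator norm
is chosen later just to apply this, and it does not occur in the conclusion. -/
theorem hasDerivAt_apply_exp_smul_of_finiteDimensional {R : Type*} [NormedRing R]
    [NormedAlgebra 𝕜 R] [FiniteDimensional 𝕜 R] (Λ : R →ₗ[𝕜] 𝕜) (a : R) :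
    HasDerivAt (fun t : 𝕜 => Λ (NormedSpace.exp (t • a))) (Λ a) 0 := by
  have := FiniteDimensional.complete 𝕜 R
  have h := hasDerivAt_exp_smul_const (𝕂 := 𝕜) a 0
  rw [zero_smul, NormedSpace.exp_zero, one_mul] at h
  exact (LinearMap.toContinuousLinearMap Λ).hasFDerivAt.comp_hasDerivAt (0 : 𝕜) h

variable (𝕜) in
theorem semiconjBy_exp_of_finiteDimensional {R : Type*} [NormedRing R]
    [NormedAlgebra 𝕜 R] [FiniteDimensional 𝕜 R] {c a a' : R} (h : SemiconjBy c a a') :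
    SemiconjBy c (NormedSpace.exp a) (NormedSpace.exp a') := by
  have := FiniteDimensional.complete 𝕜 R
  let _ : NormedAlgebra ℚ R := NormedAlgebra.restrictScalars ℚ 𝕜 R
  exact h.exp_right

variable {ι : Type*} [Fintype ι] [DecidableEq ι]

theorem hasDerivAt_apply_exp_smul (Λ : Matrix ι ι 𝕜 →ₗ[𝕜] 𝕜) (A : Matrix ι ι 𝕜) :
    HasDerivAt (fun t : 𝕜 => Λ (NormedSpace.exp (t • A))) (Λ A) 0 :=
  @hasDerivAt_apply_exp_smul_of_finiteDimensional 𝕜 _ (Matrix ι ι 𝕜) Matrix.linftyOpNormedRing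
    Matrix.linftyOpNormedAlgebra inferInstance Λ A

theorem semiconjBy_exp {C A A' : Matrix ι ι 𝕜} (h : SemiconjBy C A A') :
    SemiconjBy C (NormedSpace.exp A) (NormedSpace.exp A') :=
  @semiconjBy_exp_of_finiteDimensional 𝕜 _ (Matrix ι ι 𝕜) Matrix.linftyOpNormedRing
    Matrix.linftyOpNormedAlgebra inferInstance C A A' h

end Exponential

variable [FiniteDimensional 𝕜 V]

theorem hasDerivAt_expEnd (X : V →ₗ[𝕜] V) (Λ : (V →ₗ[𝕜] V) →ₗ[𝕜] 𝕜) :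
    HasDerivAt (fun t : 𝕜 => Λ (expEnd (t • X))) (Λ X) 0 := by
  have h := hasDerivAt_apply_exp_smul
    (Λ ∘ₗ (Matrix.toLin (finBasis 𝕜 V) (finBasis 𝕜 V)).toLinearMap)
    (LinearMap.toMatrix (finBasis 𝕜 V) (finBasis 𝕜 V) X)
  simpa [expEnd] using h

theorem expEnd_mul_expEnd_neg (X : V →ₗ[𝕜] V) : expEnd X * expEnd (-X) = 1 := by
  let A := LinearMap.toMatrix (finBasis 𝕜 V) (finBasis 𝕜 V) X
  have hc : Commute A (-A) := (Commute.refl A).neg_right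
  rw [expEnd, expEnd, map_neg, Module.End.mul_eq_comp, ← Matrix.toLin_mul,
    ← Matrix.exp_add_of_commute _ _ hc, add_neg_cancel,
    NormedSpace.exp_zero, Matrix.toLin_one]
  rfl

/-- In matrices, skewness says that `C` intertwines `-X` with the transpose of `X`; hence it
intertwines their exponentials. -/
theorem form_expEnd (C : LinearMap.BilinForm 𝕜 V) {X : V →ₗ[𝕜] V}
    (hX : ∀ u v, C (X u) v = -C u (X v)) (u v : V) :
    C (expEnd X u) v = C u (expEnd (-X) v) := by
  let b := finBasis 𝕜 V
  have h1 : C.compLeft X = C.compRight (-X) := by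
    ext u v
    simp [hX u v]
  have h2 := congrArg (LinearMap.BilinForm.toMatrix b) h1
  rw [LinearMap.BilinForm.toMatrix_compLeft, LinearMap.BilinForm.toMatrix_compRight] at h2
  have h3 : SemiconjBy (LinearMap.BilinForm.toMatrix b C) (LinearMap.toMatrix b b (-X))
      (LinearMap.toMatrix b b X).transpose := h2.symm
  have h4 := semiconjBy_exp h3
  rw [Matrix.exp_transpose] at h4
  have h5 : C.compLeft (expEnd X) = C.compRight (expEnd (-X)) := by
    apply (LinearMap.BilinForm.toMatrix b).injective
    rw [LinearMap.BilinForm.toMatrix_compLeft, LinearMap.BilinForm.toMatrix_compRight]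
    simp only [expEnd, b, LinearMap.toMatrix_toLin]
    exact h4.eq.symm
  exact LinearMap.congr_fun₂ h5 u v

/-- The operators preserving `L` form a subalgebra, closed by finite dimension, so it contains the
exponentials of its elements. -/
theorem expEnd_mem_preserving {L : Submodule 𝕜 V} {X : V →ₗ[𝕜] V} (hX : X ∈ preserving 𝕜 L) :
    expEnd X ∈ preserving 𝕜 L := by
  let b := finBasis 𝕜 V
  let S : Subalgebra 𝕜 (Matrix (Fin (finrank 𝕜 V)) (Fin (finrank 𝕜 V)) 𝕜) :=
    (preserving 𝕜 L).comap (Matrix.toLinAlgEquiv b).toAlgHom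
  have hS : IsClosed (S : Set (Matrix (Fin (finrank 𝕜 V)) (Fin (finrank 𝕜 V)) 𝕜)) :=
    Submodule.closed_of_finiteDimensional (Subalgebra.toSubmodule S)
  have h : LinearMap.toMatrix b b X ∈ S := by
    change Matrix.toLin b b (LinearMap.toMatrix b b X) ∈ preserving 𝕜 L
    rwa [Matrix.toLin_toMatrix]
  exact NormedSpace.exp_mem (R := 𝕜) (s := S) hS h

theorem exists_equiv_eq_expEnd (X : V →ₗ[𝕜] V) :
    ∃ g : V ≃ₗ[𝕜] V, (g : V →ₗ[𝕜] V) = expEnd X ∧ (g.symm : V →ₗ[𝕜] V) = expEnd (-X) := by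
  have h1 := expEnd_mul_expEnd_neg X
  have h2 := expEnd_mul_expEnd_neg (-X)
  rw [neg_neg] at h2
  exact ⟨LinearEquiv.ofLinearMap (expEnd X) (expEnd (-X)) h1 h2, rfl, rfl⟩

theorem exists_mem_Aut_of_mem_infAut {A B : LinearMap.BilinForm 𝕜 V} {X : V →ₗ[𝕜] V}
    (hX : X ∈ infAut A B) : ∃ g ∈ Aut A B, (g : V →ₗ[𝕜] V) = expEnd X := by
  obtain ⟨g, hg, hg'⟩ := exists_equiv_eq_expEnd X
  have key : ∀ C : LinearMap.BilinForm 𝕜 V, (∀ u v, C (X u) v = -C u (X v)) →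
      ∀ u v, C (g u) (g v) = C u v := by
    intro C hC u v
    have h := form_expEnd C hC u (g v)
    rwa [← hg, ← hg', LinearEquiv.coe_coe, LinearEquiv.coe_coe, LinearEquiv.symm_apply_apply] at h
  exact ⟨g, mem_Aut_iff.mpr ⟨key A hX.1, key B hX.2⟩, hg⟩

theorem mem_infAut_of_forall_expEnd {A B : LinearMap.BilinForm 𝕜 V} {X : V →ₗ[𝕜] V}
    (hX : ∀ t : 𝕜, ∃ g ∈ Aut A B, (g : V →ₗ[𝕜] V) = expEnd (t • X)) : X ∈ infAut A B := by
  have key : ∀ C : LinearMap.BilinForm 𝕜 V, (∀ g ∈ Aut A B, ∀ u v, C (g u) (g v) = C u v) →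
      ∀ u v, C (X u) v = -C u (X v) := by
    intro C hC u v
    let Λ₁ : (V →ₗ[𝕜] V) →ₗ[𝕜] 𝕜 := C.flip v ∘ₗ LinearMap.applyₗ u
    let Λ₂ : (V →ₗ[𝕜] V) →ₗ[𝕜] 𝕜 := C u ∘ₗ LinearMap.applyₗ v
    -- Invariance is used as C(exp(tX)u, v) = C(u, exp(-tX)v). Each side is linear in one
    -- exponential, so no product rule is needed to differentiate at 0.
    have h1 := (hasDerivAt_expEnd X Λ₁).sub (hasDerivAt_expEnd (-X) Λ₂)
    have h2 : (fun t : 𝕜 => Λ₁ (expEnd (t • X))) - (fun t : 𝕜 => Λ₂ (expEnd (t • (-X)))) =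
        fun _ => 0 := by
      funext t
      obtain ⟨g, hg, e⟩ := hX t
      have h3 := LinearMap.congr_fun (expEnd_mul_expEnd_neg (t • X)) v
      have h4 := hC g hg u (expEnd (-(t • X)) v)
      have e' : ∀ w, expEnd (t • X) w = g w := fun w => by rw [← e]; rfl
      rw [Module.End.mul_apply, e'] at h3
      rw [h3] at h4
      simp only [Pi.sub_apply, Λ₁, Λ₂, LinearMap.comp_apply, LinearMap.applyₗ_apply_apply]
      rw [smul_neg, ← h4, e']
      exact sub_self _
    rw [h2] at h1
    have h3 := h1.unique (hasDerivAt_const (0 : 𝕜) (0 : 𝕜))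
    simp only [map_neg, sub_neg_eq_add] at h3
    exact eq_neg_of_add_eq_zero_left h3
  exact ⟨key A fun g hg => (mem_Aut_iff.mp hg).1, key B fun g hg => (mem_Aut_iff.mp hg).2⟩

/-- By dimension, an invertible map that sends `L` into itself sends it onto itself. -/
theorem mem_autStab_iff {A B : LinearMap.BilinForm 𝕜 V} {L : Submodule 𝕜 V} {g : V ≃ₗ[𝕜] V} :
    g ∈ autStab A B L ↔ g ∈ Aut A B ∧ ∀ u ∈ L, g u ∈ L := by
  rw [autStab, Subgroup.mem_inf, MulAction.mem_stabilizer_iff]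
  refine and_congr_right fun _ => ?_
  have e : g • L = L.map (g : V →ₗ[𝕜] V) := rfl
  rw [e]
  constructor
  · intro h u hu
    rw [← h]
    exact Submodule.mem_map_of_mem hu
  · intro h
    refine Submodule.eq_of_le_of_finrank_eq (Submodule.map_le_iff_le_comap.mpr h) ?_
    exact LinearEquiv.finrank_map_eq g L

theorem lieAlg_Aut (A B : LinearMap.BilinForm 𝕜 V) : lieAlg (Aut A B) = infAut A B := by
  apply le_antisymm
  · exact Submodule.span_le.mpr fun X hX => mem_infAut_of_forall_expEnd hX
  · exact fun X hX => Submodule.subset_span fun t =>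
      exists_mem_Aut_of_mem_infAut (Submodule.smul_mem _ t hX)

theorem lieAlg_autStab (A B : LinearMap.BilinForm 𝕜 V) (L : Submodule 𝕜 V) :
    lieAlg (autStab A B L) = infAut A B ⊓ Subalgebra.toSubmodule (preserving 𝕜 L) := by
  apply le_antisymm
  · refine Submodule.span_le.mpr fun X hX => ⟨?_, fun u hu => ?_⟩
    · refine mem_infAut_of_forall_expEnd fun t => ?_
      obtain ⟨g, hg, e⟩ := hX t
      exact ⟨g, (mem_autStab_iff.mp hg).1, e⟩
    · rw [← Subspace.forall_mem_dualAnnihilator_apply_eq_zero_iff]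
      intro f hf
      rw [Submodule.mem_dualAnnihilator] at hf
      let Λ : (V →ₗ[𝕜] V) →ₗ[𝕜] 𝕜 := f ∘ₗ LinearMap.applyₗ u
      have h1 := hasDerivAt_expEnd X Λ
      have h2 : (fun t : 𝕜 => Λ (expEnd (t • X))) = fun _ => 0 := by
        funext t
        obtain ⟨g, hg, e⟩ := hX t
        rw [← e]
        exact hf _ ((mem_autStab_iff.mp hg).2 u hu)
      rw [h2] at h1
      exact h1.unique (hasDerivAt_const (0 : 𝕜) (0 : 𝕜))
  · rintro X ⟨hX, hL⟩
    refine Submodule.subset_span fun t => ?_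
    obtain ⟨g, hg, e⟩ := exists_mem_Aut_of_mem_infAut (Submodule.smul_mem _ t hX)
    refine ⟨g, mem_autStab_iff.mpr ⟨hg, fun u hu => ?_⟩, e⟩
    have h := expEnd_mem_preserving (Submodule.smul_mem _ t hL) u hu
    rwa [← e] at h

end LieAlgebra

/-! ### Invariant Lagrangian subspaces and their extension to Darboux bases of chains. -/

section Lagrangian

open Module

variable {K : Type*} [Field K] {V : Type*} [AddCommGroup V] [Module K V] {κ : Type*}

/-- `B` is a symplectic form and `P` is self-adjoint with respect to it. -/
structure IsSymplecticPair (B : LinearMap.BilinForm K V) (P : V →ₗ[K] V) : Prop where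
  nondegenerate : B.Nondegenerate
  skew : ∀ u v, B u v = -B v u
  adjoint : ∀ u v, B (P u) v = B u (P v)

/-- `L` is a `P`-invariant Lagrangian subspace for `B`. -/
structure IsInvariantLagrangian (B : LinearMap.BilinForm K V) (P : V →ₗ[K] V)
    (L : Submodule K V) : Prop where
  isotropic : ∀ u ∈ L, ∀ v ∈ L, B u v = 0
  invariant : ∀ u ∈ L, P u ∈ L
  finrank_eq : 2 * finrank K L = finrank K V

/-- A Darboux basis consisting of Jordan chains: the first half is formed by the chains of the
vectors `egen c`, and the second half by the reversed chains of the vectors `fgen c`. -/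
structure DarbouxChains (B : LinearMap.BilinForm K V) (P : V →ₗ[K] V) (ν : κ → ℕ) where
  egen : κ → V
  fgen : κ → V
  basis : Basis ((Σ c, Fin (ν c)) ⊕ (Σ c, Fin (ν c))) K V
  basis_inl : ∀ x, basis (Sum.inl x) = (P ^ (x.2 : ℕ)) (egen x.1)
  basis_inr : ∀ x, basis (Sum.inr x) = (P ^ (ν x.1 - 1 - x.2)) (fgen x.1)
  pow_egen : ∀ c, (P ^ ν c) (egen c) = 0
  pow_fgen : ∀ c, (P ^ ν c) (fgen c) = 0
  form_inl_inl : ∀ x y, B (basis (Sum.inl x)) (basis (Sum.inl y)) = 0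
  form_inr_inr : ∀ x y, B (basis (Sum.inr x)) (basis (Sum.inr y)) = 0
  form_inl_inr_self : ∀ x, B (basis (Sum.inl x)) (basis (Sum.inr x)) = 1
  form_inl_inr_of_ne : ∀ x y, x ≠ y → B (basis (Sum.inl x)) (basis (Sum.inr y)) = 0

/-- The span of the first half of the basis. -/
def DarbouxChains.lagrangian {B : LinearMap.BilinForm K V} {P : V →ₗ[K] V} {ν : κ → ℕ}
    (S : DarbouxChains B P ν) : Submodule K V :=
  Submodule.span K (Set.range fun x => S.basis (Sum.inl x))

theorem coe_restrict_pow {P : V →ₗ[K] V} {L : Submodule K V} (hL : ∀ u ∈ L, P u ∈ L) (k : ℕ)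
    (u : L) : (((P.restrict hL) ^ k) u : V) = (P ^ k) (u : V) := by
  induction k with
  | zero => simp
  | succ k ih => rw [pow_succ', pow_succ', Module.End.mul_apply, Module.End.mul_apply,
      LinearMap.coe_restrict_apply, ih]

theorem IsSymplecticPair.adjoint_pow {B : LinearMap.BilinForm K V} {P : V →ₗ[K] V}
    (h : IsSymplecticPair B P) (k : ℕ) (u v : V) : B ((P ^ k) u) v = B u ((P ^ k) v) :=
  selfAdjForms_pow (φ := P) (s := B) h.adjoint k u v

/-- Pairing a linear relation with the dual vector of the family isolates each coefficient. -/
theorem linearIndependent_of_darboux {B : LinearMap.BilinForm K V} {ι : Type*} [Fintype ι]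
    {e f : ι → V} (hee : ∀ x y, B (e x) (e y) = 0) (hff : ∀ x y, B (f x) (f y) = 0)
    (hself : ∀ x, B (e x) (f x) = 1) (hne : ∀ x y, x ≠ y → B (e x) (f y) = 0) :
    LinearIndependent K (Sum.elim e f) := by
  classical
  rw [Fintype.linearIndependent_iff]
  intro c hc
  rw [Fintype.sum_sum_type] at hc
  simp only [Sum.elim_inl, Sum.elim_inr] at hc
  rintro (x | x)
  · have h := congrArg (fun v => B v (f x)) hc
    simp only [map_add, map_sum, map_smul, LinearMap.add_apply, LinearMap.sum_apply,
      LinearMap.smul_apply, hff, smul_zero, Finset.sum_const_zero, add_zero, map_zero,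
      LinearMap.zero_apply] at h
    rwa [Finset.sum_eq_single x (fun y _ hy => by rw [hne y x hy, smul_zero]) (by simp), hself,
      smul_eq_mul, mul_one] at h
  · have h := congrArg (fun v => B (e x) v) hc
    simp only [map_add, map_sum, map_smul, hee, smul_zero, Finset.sum_const_zero, zero_add,
      map_zero] at h
    rwa [Finset.sum_eq_single x (fun y _ hy => by rw [hne x y hy.symm, smul_zero]) (by simp), hself,
      smul_eq_mul, mul_one] at h

variable [FiniteDimensional K V] {B : LinearMap.BilinForm K V} {P : V →ₗ[K] V}
  {L : Submodule K V}

theorem IsSymplecticPair.exists_form_eq (h : IsSymplecticPair B P) (l : L →ₗ[K] K) :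
    ∃ v, ∀ u : L, B u v = l u := by
  obtain ⟨l', hl'⟩ := LinearMap.exists_extend l
  refine ⟨-((B.toDual h.nondegenerate).symm l'), fun u => ?_⟩
  rw [map_neg, h.skew, neg_neg, LinearMap.BilinForm.apply_toDual_symm_apply, ← hl']
  rfl

theorem IsInvariantLagrangian.orthogonal_eq (h : IsSymplecticPair B P)
    (hL : IsInvariantLagrangian B P L) : B.orthogonal L = L := by
  symm
  refine Submodule.eq_of_le_of_finrank_eq (fun u hu v hv => hL.isotropic v hv u hu) ?_
  rw [LinearMap.BilinForm.finrank_orthogonal h.nondegenerate]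
  have := hL.finrank_eq
  omega

theorem IsInvariantLagrangian.mem_of_form_eq_zero (h : IsSymplecticPair B P)
    (hL : IsInvariantLagrangian B P L) {v : V} (hv : ∀ u ∈ L, B u v = 0) : v ∈ L := by
  rw [← hL.orthogonal_eq h]
  exact hv

/-- The kernels of the powers of `P` measure whether an invariant Lagrangian subspace is pure. -/
theorem IsInvariantLagrangian.exists_pow_eq (h : IsSymplecticPair B P)
    (hL : IsInvariantLagrangian B P L) (k : ℕ)
    (hker : finrank K (LinearMap.ker (P ^ k)) =
      2 * finrank K (LinearMap.ker ((P.restrict hL.invariant) ^ k)))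
    {w : V} (hw : (P ^ k) w ∈ L) : ∃ m ∈ L, (P ^ k) m = (P ^ k) w := by
  have hker' : finrank K (L ⊓ LinearMap.ker (P ^ k) : Submodule K V) =
      finrank K (LinearMap.ker ((P.restrict hL.invariant) ^ k)) := by
    have : LinearMap.ker ((P.restrict hL.invariant) ^ k) =
        (L ⊓ LinearMap.ker (P ^ k)).comap L.subtype := by
      ext u
      rw [LinearMap.mem_ker, Submodule.mem_comap, Submodule.mem_inf, LinearMap.mem_ker,
        ← Submodule.coe_eq_zero, coe_restrict_pow]
      simp
    rw [this]
    exact (Submodule.comapSubtypeEquivOfLe inf_le_left).finrank_eq.symm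
  have h1 : finrank K (L.map (P ^ k)) +
      finrank K (LinearMap.ker ((P.restrict hL.invariant) ^ k)) = finrank K L := by
    rw [← LinearMap.finrank_range_add_finrank_ker ((P ^ k).domRestrict L), ← Submodule.map_top,
      LinearMap.domRestrict, Submodule.map_comp, Submodule.map_subtype_top]
    congr 1
    suffices e : LinearMap.ker ((P.restrict hL.invariant) ^ k) =
        LinearMap.ker ((P ^ k) ∘ₗ L.subtype) by rw [e]
    ext u
    rw [LinearMap.mem_ker, LinearMap.mem_ker, ← Submodule.coe_eq_zero, coe_restrict_pow]
    rfl
  -- By the hypothesis on kernels, this orthogonal complement has the dimension of `P ^ k` applied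
  -- to `L`. As the latter lies in L ∩ Im P^k, the two coincide.
  have h2 : L ⊓ LinearMap.range (P ^ k) ≤ B.orthogonal (L ⊔ LinearMap.ker (P ^ k)) := by
    rintro _ ⟨hu, ⟨v, rfl⟩⟩
    intro x hx
    obtain ⟨y, hy, z, hz, rfl⟩ := Submodule.mem_sup.mp hx
    change B (y + z) _ = 0
    rw [map_add, LinearMap.add_apply, hL.isotropic y hy _ hu, ← h.adjoint_pow,
      LinearMap.mem_ker.mp hz, map_zero, LinearMap.zero_apply, add_zero]
  have h3 := Submodule.finrank_mono h2
  rw [LinearMap.BilinForm.finrank_orthogonal h.nondegenerate] at h3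
  have h4 := Submodule.finrank_sup_add_finrank_inf_eq L (LinearMap.ker (P ^ k))
  have h5 := hL.finrank_eq
  have h6 : L.map (P ^ k) ≤ L ⊓ LinearMap.range (P ^ k) := by
    rintro _ ⟨u, hu, rfl⟩
    refine ⟨?_, u, rfl⟩
    rw [← coe_restrict_pow hL.invariant k ⟨u, hu⟩]
    exact Subtype.coe_prop _
  have h7 := Submodule.eq_of_le_of_finrank_le h6 (by omega)
  have h8 : (P ^ k) w ∈ L.map (P ^ k) := by
    rw [h7]
    exact ⟨hw, w, rfl⟩
  obtain ⟨m, hm, e⟩ := h8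
  exact ⟨m, hm, e⟩

/-- An invariant Lagrangian subspace whose Jordan type is half of that of the ambient space is the
first half of a Darboux basis consisting of Jordan chains. -/
theorem IsInvariantLagrangian.exists_darbouxChains [CharZero K] [Fintype κ]
    (h : IsSymplecticPair B P) (hL : IsInvariantLagrangian B P L) {ν : κ → ℕ} (hν : ∀ c, 0 < ν c)
    (J : JordanBasis (P.restrict hL.invariant) ν)
    (hker : ∀ k, finrank K (LinearMap.ker (P ^ k)) =
      2 * finrank K (LinearMap.ker ((P.restrict hL.invariant) ^ k))) :
    ∃ S : DarbouxChains B P ν, S.lagrangian = L := by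
  classical
  let eg : κ → V := fun c => J.gen c
  have hegL : ∀ c k, (P ^ k) (eg c) ∈ L := fun c k => by
    rw [← coe_restrict_pow hL.invariant]
    exact Subtype.coe_prop _
  have heg : ∀ c k, ν c ≤ k → (P ^ k) (eg c) = 0 := fun c k hk => by
    rw [← coe_restrict_pow hL.invariant, J.pow_gen_of_le hk]
    rfl
  have hext : ∀ v, (∀ c k, B ((P ^ k) (eg c)) v = 0) → ∀ u ∈ L, B u v = 0 := by
    intro v hv u hu
    have h0 : LinearMap.flip B v ∘ₗ L.subtype = 0 := J.hom_ext fun c k => by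
      rw [LinearMap.comp_apply, Submodule.subtype_apply, coe_restrict_pow]
      exact hv c k
    exact LinearMap.congr_fun h0 ⟨u, hu⟩
  -- The dual generator `f` must pair to 1 with the last vector of the chain `c` and to 0 with all
  -- other vectors of `L`, and must itself generate a chain of length `ν c`.
  have step1 : ∀ c, ∃ f, (P ^ ν c) f = 0 ∧
      ∀ a k, B ((P ^ k) (eg a)) f = if a = c ∧ k + 1 = ν c then 1 else 0 := by
    intro c
    obtain ⟨f0, hf0⟩ := h.exists_form_eq (L := L)
      (J.basis.coord ⟨c, ⟨ν c - 1, Nat.sub_lt (hν c) one_pos⟩⟩)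
    have hf0' : ∀ a k, B ((P ^ k) (eg a)) f0 = if a = c ∧ k + 1 = ν c then 1 else 0 := by
      intro a k
      have h1 := hf0 (((P.restrict hL.invariant) ^ k) (J.gen a))
      rw [coe_restrict_pow] at h1
      rw [h1]
      rcases lt_or_ge k (ν a) with hk | hk
      · rw [J.pow_gen_of_lt hk, Basis.coord_apply, Basis.repr_self, Finsupp.single_apply]
        congr 1
        simp only [Sigma.mk.injEq, eq_iff_iff]
        constructor
        · rintro ⟨rfl, h'⟩
          simp only [heq_eq_eq, Fin.mk.injEq] at h'
          exact ⟨rfl, by omega⟩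
        · rintro ⟨rfl, h'⟩
          refine ⟨rfl, ?_⟩
          simp only [heq_eq_eq, Fin.mk.injEq]
          omega
      · rw [J.pow_gen_of_le hk, map_zero, if_neg]
        rintro ⟨rfl, h'⟩
        omega
    -- The vector `f0` represents the right functional, but `P ^ ν c` need not kill it. The defect
    -- is orthogonal to `L`, hence lies in `L`, and it equals `P ^ ν c` of a vector of `L`.
    -- Subtracting that vector leaves the pairing with `L` unchanged.
    have hmem : (P ^ ν c) f0 ∈ L := by
      refine hL.mem_of_form_eq_zero h (hext _ fun a k => ?_)
      rw [← h.adjoint_pow, ← Module.End.mul_apply, ← pow_add, hf0', if_neg]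
      rintro ⟨rfl, h'⟩
      omega
    obtain ⟨m, hm, hm'⟩ := hL.exists_pow_eq h (ν c) (hker _) hmem
    refine ⟨f0 - m, by rw [map_sub, hm', sub_self], fun a k => ?_⟩
    rw [map_sub, hL.isotropic _ (hegL a k) _ hm, sub_zero, hf0']
  choose f1 hf1 hef using step1
  let e : (Σ c, Fin (ν c)) → V := fun x => (P ^ (x.2 : ℕ)) (eg x.1)
  let f : (Σ c, Fin (ν c)) → V := fun x => (P ^ (ν x.1 - 1 - x.2)) (f1 x.1)
  have heL : ∀ x, e x ∈ L := fun x => hegL _ _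
  have he_f : ∀ x y, B (e x) (f y) = if x = y then 1 else 0 := by
    rintro ⟨a, i, hi⟩ ⟨c, k, hk⟩
    simp only [e, f]
    rw [← h.adjoint_pow, ← Module.End.mul_apply, ← pow_add, hef]
    congr 1
    simp only [Sigma.mk.injEq, eq_iff_iff]
    constructor
    · rintro ⟨rfl, h'⟩
      refine ⟨rfl, ?_⟩
      simp only [heq_eq_eq, Fin.mk.injEq]
      omega
    · rintro ⟨rfl, h'⟩
      simp only [heq_eq_eq, Fin.mk.injEq] at h'
      exact ⟨rfl, by omega⟩
  have hspan : Submodule.span K (Set.range e) = L := by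
    have h1 : e = L.subtype ∘ J.basis := by
      funext x
      rw [Function.comp_apply, J.basis_apply, Submodule.subtype_apply, coe_restrict_pow]
    rw [h1, Set.range_comp, Submodule.span_image, J.basis.span_eq, Submodule.map_subtype_top]
  have hpair : ∀ u ∈ L, (∀ y, B u (f y) = 0) → u = 0 := by
    intro u hu hy
    rw [← hspan, Submodule.mem_span_range_iff_exists_fun] at hu
    obtain ⟨c, rfl⟩ := hu
    refine Finset.sum_eq_zero fun x _ => ?_
    have h1 := hy x
    rw [map_sum, LinearMap.sum_apply, Finset.sum_eq_single x (fun y _ hyx => by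
      rw [map_smul, LinearMap.smul_apply, he_f, if_neg hyx, smul_zero]) (by simp), map_smul,
      LinearMap.smul_apply, he_f, if_pos rfl, smul_eq_mul, mul_one] at h1
    rw [h1, zero_smul]
  have hPf : ∀ j y, (P ^ j) (f y) = 0 ∨ ∃ z, (P ^ j) (f y) = f z := by
    rintro j ⟨c, k, hk⟩
    simp only [f, ← Module.End.mul_apply, ← pow_add]
    rcases le_or_gt j k with hj | hj
    · right
      refine ⟨⟨c, ⟨k - j, by omega⟩⟩, ?_⟩
      rw [show j + (ν c - 1 - k) = ν c - 1 - (k - j) by omega]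
    · left
      rw [show j + (ν c - 1 - k) = (j - k - 1) + ν c by omega, pow_add, Module.End.mul_apply, hf1,
        map_zero]
  -- The vectors `f` are dual to the `e` but need not be isotropic. This is the element of `L`
  -- having the same pairings with all `f` as `f1 c`.
  let g : κ → V := fun c => ∑ x, B (f1 c) (f x) • e x
  have hgL : ∀ c, g c ∈ L := fun c => L.sum_mem fun x _ => L.smul_mem _ (heL x)
  have hPgL : ∀ j c, (P ^ j) (g c) ∈ L := fun j c => by
    rw [← coe_restrict_pow hL.invariant j ⟨g c, hgL c⟩]
    exact Subtype.coe_prop _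
  have hg : ∀ c y, B (g c) (f y) = B (f1 c) (f y) := by
    intro c y
    simp only [g]
    rw [map_sum, LinearMap.sum_apply, Finset.sum_eq_single y (fun x _ hxy => by
      rw [map_smul, LinearMap.smul_apply, he_f, if_neg hxy, smul_zero]) (by simp), map_smul,
      LinearMap.smul_apply, he_f, if_pos rfl, smul_eq_mul, mul_one]
  have hPg : ∀ c j y, B ((P ^ j) (g c)) (f y) = B ((P ^ j) (f1 c)) (f y) := by
    intro c j y
    rw [h.adjoint_pow, h.adjoint_pow]
    rcases hPf j y with h0 | ⟨z, hz⟩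
    · rw [h0, map_zero, map_zero]
    · rw [hz, hg]
  -- Each of the two cross terms of `B (f' x) (f' y)` removes half of `B (f x) (f y)`.
  let fg : κ → V := fun c => f1 c - (2 : K)⁻¹ • g c
  let f' : (Σ c, Fin (ν c)) → V := fun x => (P ^ (ν x.1 - 1 - x.2)) (fg x.1)
  have hfg : ∀ c, (P ^ ν c) (fg c) = 0 := by
    intro c
    -- The chain length is kept: this vector of `L` has the same pairings with the `f` as `(P ^ ν c)
    -- (f1 c) = 0`, and the `f` separate the vectors of `L`.
    have : (P ^ ν c) (g c) = 0 := hpair _ (hPgL _ _) fun y => by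
      rw [hPg, hf1, map_zero, LinearMap.zero_apply]
    rw [map_sub, map_smul, this, hf1, smul_zero, sub_zero]
  have hf' : ∀ x, f' x = f x - (2 : K)⁻¹ • (P ^ (ν x.1 - 1 - x.2)) (g x.1) := fun x => by
    simp only [f', f, fg, map_sub, map_smul]
  have he_f' : ∀ x y, B (e x) (f' y) = if x = y then 1 else 0 := by
    intro x y
    rw [hf', map_sub, map_smul, hL.isotropic _ (heL x) _ (hPgL _ _), smul_zero, sub_zero, he_f]
  have hf'f' : ∀ x y, B (f' x) (f' y) = 0 := by
    intro x y
    have h1 := hPg x.1 (ν x.1 - 1 - x.2) y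
    have h2 := hPg y.1 (ν y.1 - 1 - y.2) x
    change _ = B (f x) (f y) at h1
    change _ = B (f y) (f x) at h2
    have h3 := h.skew (f x) ((P ^ (ν y.1 - 1 - y.2)) (g y.1))
    rw [h2] at h3
    rw [hf', hf']
    simp only [map_sub, map_smul, LinearMap.sub_apply, LinearMap.smul_apply, smul_eq_mul]
    rw [h1, h3, hL.isotropic _ (hPgL _ _) _ (hPgL _ _), h.skew (f y)]
    have : (2 : K) ≠ 0 := two_ne_zero
    field_simp
    ring
  have hli : LinearIndependent K (Sum.elim e f') :=
    linearIndependent_of_darboux (fun x y => hL.isotropic _ (heL x) _ (heL y)) hf'f'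
      (fun x => by rw [he_f', if_pos rfl]) (fun x y hxy => by rw [he_f', if_neg hxy])
  have hcard : Fintype.card ((Σ c, Fin (ν c)) ⊕ (Σ c, Fin (ν c))) = finrank K V := by
    rw [Fintype.card_sum, ← hL.finrank_eq, finrank_eq_card_basis J.basis]
    ring
  let b := Basis.mk hli (hli.span_eq_top_of_card_eq_finrank' hcard).ge
  have hb1 : ∀ x, b (Sum.inl x) = e x := fun x => by simp [b]
  have hb2 : ∀ x, b (Sum.inr x) = f' x := fun x => by simp [b]
  refine ⟨⟨eg, fg, b, hb1, hb2, fun c => heg c _ le_rfl, hfg, fun x y => ?_, fun x y => ?_,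
    fun x => ?_, fun x y hxy => ?_⟩, ?_⟩
  · rw [hb1, hb1]
    exact hL.isotropic _ (heL x) _ (heL y)
  · rw [hb2, hb2, hf'f']
  · rw [hb1, hb2, he_f', if_pos rfl]
  · rw [hb1, hb2, he_f', if_neg hxy]
  · simp only [DarbouxChains.lagrangian, hb1]
    exact hspan

end Lagrangian

/-! ### The space of forms `B (X u) v` on `L`: bounds for its dimension. -/

section Rank

open Module

variable {K : Type*} [Field K] {V : Type*} [AddCommGroup V] [Module K V] {κ : Type*}

theorem finrank_map_add_finrank_inf_ker {W : Type*} [AddCommGroup W] [Module K W]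
    (S : Submodule K V) [FiniteDimensional K S] (f : V →ₗ[K] W) :
    finrank K (S.map f) + finrank K (S ⊓ LinearMap.ker f : Submodule K V) = finrank K S := by
  have h : LinearMap.ker (f.domRestrict S) = (S ⊓ LinearMap.ker f).comap S.subtype := by
    ext u
    rw [LinearMap.mem_ker, Submodule.mem_comap, Submodule.mem_inf, LinearMap.mem_ker]
    simp
  have h' := LinearMap.finrank_range_add_finrank_ker (f.domRestrict S)
  rw [h, (Submodule.comapSubtypeEquivOfLe (p := S ⊓ LinearMap.ker f) inf_le_left).finrank_eq,
    ← Submodule.map_top, LinearMap.domRestrict, Submodule.map_comp, Submodule.map_subtype_top] at h'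
  exact h'

/-- The form `B (Y u) v` on `L` defined by a map `Y` from `L`. -/
def pairingForm (B : LinearMap.BilinForm K V) (L : Submodule K V) :
    (L →ₗ[K] V) →ₗ[K] LinearMap.BilinForm K L where
  toFun Y := LinearMap.flip (LinearMap.flip B ∘ₗ L.subtype) ∘ₗ Y
  map_add' _ _ := LinearMap.comp_add _ _ _
  map_smul' _ _ := LinearMap.comp_smul _ _ _

theorem pairingForm_apply (B : LinearMap.BilinForm K V) (L : Submodule K V) (Y : L →ₗ[K] V)
    (u v : L) : pairingForm B L Y u v = B (Y u) v := rfl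

/-- The form `B (X u) v` on `L` defined by an operator `X`. -/
def operatorForm (B : LinearMap.BilinForm K V) (L : Submodule K V) :
    (V →ₗ[K] V) →ₗ[K] LinearMap.BilinForm K L :=
  pairingForm B L ∘ₗ LinearMap.lcomp K V L.subtype

theorem operatorForm_apply (B : LinearMap.BilinForm K V) (L : Submodule K V) (X : V →ₗ[K] V)
    (u v : L) : operatorForm B L X u v = B (X u) v := rfl

/-- The operators that are skew-adjoint with respect to `B` and commute with `P`. -/
def skewCommutant (B : LinearMap.BilinForm K V) (P : V →ₗ[K] V) : Submodule K (V →ₗ[K] V) where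
  carrier := {X | (∀ u, P (X u) = X (P u)) ∧ ∀ u v, B (X u) v = -B u (X v)}
  zero_mem' := by simp
  add_mem' := by
    rintro X Y ⟨hA, hB⟩ ⟨hA', hB'⟩
    constructor
    · intro u
      simp only [LinearMap.add_apply, map_add, hA u, hA' u]
    · intro u v
      simp only [LinearMap.add_apply, map_add, hB u v, hB' u v]
      ring
  smul_mem' := by
    rintro c X ⟨hA, hB⟩
    exact ⟨fun u => by simp [hA u], fun u v => by simp [hB u v]⟩

theorem IsInvariantLagrangian.map_pairingForm_le {B : LinearMap.BilinForm K V}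
    {P : V →ₗ[K] V} {L : Submodule K V} (h : IsSymplecticPair B P)
    (hL : IsInvariantLagrangian B P L) :
    (intertwiners (P.restrict hL.invariant) P).map (pairingForm B L) ≤
      selfAdjForms (P.restrict hL.invariant) := by
  rintro _ ⟨Y, hY, rfl⟩ u v
  rw [pairingForm_apply, pairingForm_apply, ← hY, h.adjoint]
  rfl

variable [FiniteDimensional K V] {B : LinearMap.BilinForm K V} {P : V →ₗ[K] V}
  {L : Submodule K V}

theorem IsInvariantLagrangian.mem_of_form_eq_zero' (h : IsSymplecticPair B P)
    (hL : IsInvariantLagrangian B P L) {v : V} (hv : ∀ u : L, B v u = 0) : v ∈ L :=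
  hL.mem_of_form_eq_zero h fun u hu => by rw [h.skew, hv ⟨u, hu⟩, neg_zero]

/-- Rank-nullity: since `L` is its own orthogonal, an intertwiner `L → V` gives the zero form
exactly when its values lie in `L`. -/
theorem IsInvariantLagrangian.finrank_map_pairingForm (h : IsSymplecticPair B P)
    (hL : IsInvariantLagrangian B P L) :
    finrank K ((intertwiners (P.restrict hL.invariant) P).map (pairingForm B L)) +
      finrank K (intertwiners (P.restrict hL.invariant) (P.restrict hL.invariant)) =
      finrank K (intertwiners (P.restrict hL.invariant) P) := by
  rw [← finrank_map_add_finrank_inf_ker (W := LinearMap.BilinForm K L)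
    (intertwiners (P.restrict hL.invariant) P) (pairingForm B L)]
  congr 1
  let j : (L →ₗ[K] L) →ₗ[K] (L →ₗ[K] V) :=
    { toFun := fun Y => L.subtype ∘ₗ Y
      map_add' := fun _ _ => LinearMap.comp_add _ _ _
      map_smul' := fun _ _ => LinearMap.comp_smul _ _ _ }
  have hj : Function.Injective j := fun Y Z hYZ => LinearMap.ext fun u =>
    Subtype.ext (LinearMap.congr_fun hYZ u)
  have e : (intertwiners (P.restrict hL.invariant) (P.restrict hL.invariant)).map j =
      intertwiners (P.restrict hL.invariant) P ⊓ LinearMap.ker (pairingForm B L) := by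
    ext Y
    constructor
    · rintro ⟨Z, hZ, rfl⟩
      refine ⟨fun u => congrArg Subtype.val (hZ u), ?_⟩
      refine LinearMap.mem_ker.mpr ?_
      ext u v
      exact hL.isotropic _ (Z u).2 _ v.2
    · rintro ⟨hY, hker⟩
      have hmem : ∀ u, Y u ∈ L := fun u => hL.mem_of_form_eq_zero' h fun v =>
        LinearMap.congr_fun₂ (LinearMap.mem_ker.mp hker) u v
      exact ⟨Y.codRestrict L hmem, fun u => Subtype.ext (hY u), rfl⟩
  rw [← e]
  exact (Submodule.equivMapOfInjective j hj _).finrank_eq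

theorem IsInvariantLagrangian.mem_ker_operatorForm (h : IsSymplecticPair B P)
    (hL : IsInvariantLagrangian B P L) {X : V →ₗ[K] V} :
    X ∈ LinearMap.ker (operatorForm B L) ↔ ∀ u ∈ L, X u ∈ L := by
  rw [LinearMap.mem_ker]
  constructor
  · intro hX u hu
    exact hL.mem_of_form_eq_zero' h fun v => LinearMap.congr_fun₂ hX ⟨u, hu⟩ v
  · intro hX
    ext u v
    exact hL.isotropic _ (hX u u.2) _ v.2

/-- An upper bound for the rank of the restriction map on an invariant Lagrangian subspace. -/
theorem IsInvariantLagrangian.two_mul_finrank_le [CharZero K] [Fintype κ]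
    (h : IsSymplecticPair B P) (hL : IsInvariantLagrangian B P L) {μ : κ → ℕ}
    (J : JordanBasis (P.restrict hL.invariant) μ) :
    2 * finrank K ((skewCommutant B P).map (operatorForm B L)) +
      finrank K (intertwiners (P.restrict hL.invariant) (P.restrict hL.invariant)) ≤
      finrank K (intertwiners (P.restrict hL.invariant) P) + finrank K L := by
  -- Applied to the forms of all intertwiners `L → V`, a space stable because an intertwiner can be
  -- precomposed with an endomorphism of `L` commuting with `P`.
  have h1 := J.two_mul_finrank_symm_le _ (hL.map_pairingForm_le h) (by
    rintro θ hθ _ ⟨Y, hY, rfl⟩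
    refine ⟨Y ∘ₗ θ, fun u => ?_, rfl⟩
    rw [LinearMap.comp_apply, LinearMap.comp_apply, hY, hθ])
  have h2 : (skewCommutant B P).map (operatorForm B L) ≤
      (intertwiners (P.restrict hL.invariant) P).map (pairingForm B L) ⊓ symmForms K L := by
    rintro _ ⟨X, hX, rfl⟩
    refine ⟨⟨X ∘ₗ L.subtype, fun u => hX.1 u, rfl⟩, fun u v => ?_⟩
    rw [operatorForm_apply, operatorForm_apply, hX.2, h.skew, neg_neg]
  have h3 := Submodule.finrank_mono h2
  have h4 := hL.finrank_map_pairingForm h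
  omega

/-- The rank of the restriction map on an invariant Lagrangian subspace that is the image of an
equivariant projection. -/
theorem IsInvariantLagrangian.le_two_mul_finrank [CharZero K] [Fintype κ]
    (h : IsSymplecticPair B P) (hL : IsInvariantLagrangian B P L) {μ : κ → ℕ}
    (J : JordanBasis (P.restrict hL.invariant) μ) (p : V →ₗ[K] L) (hp : ∀ u : L, p u = u)
    (hpP : ∀ u, p (P u) = P.restrict hL.invariant (p u)) :
    finrank K (intertwiners (P.restrict hL.invariant) P) + finrank K L ≤
      2 * finrank K ((skewCommutant B P).map (operatorForm B L)) +
      finrank K (intertwiners (P.restrict hL.invariant) (P.restrict hL.invariant)) := by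
  have h1 := J.le_two_mul_finrank_symm
  have h2 : selfAdjForms (P.restrict hL.invariant) ⊓ symmForms K L ≤
      (skewCommutant B P).map (operatorForm B L) := by
    rintro s ⟨hs, hsymm⟩
    -- The form is pulled back to `V` along the projection. The operator that represents it through
    -- `B` commutes with `P` by equivariance and is skew because `s` is symmetric and `B` is skew.
    let s' : LinearMap.BilinForm K V := LinearMap.flip (LinearMap.flip (s ∘ₗ p) ∘ₗ p)
    have hs' : ∀ u v, s' u v = s (p u) (p v) := fun u v => rfl
    let X := s'.symmCompOfNondegenerate B h.nondegenerate
    have hX : ∀ u v, B (X u) v = s' u v := fun u v =>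
      LinearMap.BilinForm.symmCompOfNondegenerate_left_apply s' h.nondegenerate v u
    refine ⟨X, ⟨fun u => ?_, fun u v => ?_⟩, ?_⟩
    · rw [← sub_eq_zero]
      refine h.nondegenerate.1 _ fun v => ?_
      rw [map_sub, LinearMap.sub_apply, h.adjoint, hX, hX, hs', hs', hpP, hpP, hs, sub_self]
    · rw [h.skew u, hX, hX, neg_neg, hs', hs', hsymm]
    · ext u v
      rw [operatorForm_apply, hX, hs', hp, hp]
  have h3 := Submodule.finrank_mono h2
  have h4 := hL.finrank_map_pairingForm h
  have h5 := Submodule.finrank_mono (hL.map_pairingForm_le h)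
  omega

end Rank

/-! ### Standard Lagrangians maximize the rank. -/

section Darboux

open Module

variable {K : Type*} [Field K] {V : Type*} [AddCommGroup V] [Module K V] {κ : Type*}

theorem sub_one_sub_rev {n : ℕ} (k : Fin n) : n - 1 - (k.rev : ℕ) = k := by
  have := k.2
  rw [Fin.val_rev]
  omega

namespace DarbouxChains

variable {B : LinearMap.BilinForm K V} {P : V →ₗ[K] V} {ν : κ → ℕ} (S : DarbouxChains B P ν)
include S

/-- The Jordan basis of the ambient space. -/
def ambientJordanBasis : JordanBasis P (Sum.elim ν ν) where
  gen := Sum.elim S.egen S.fgen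
  basis := S.basis.reindex <|
    ((Equiv.refl _).sumCongr (Equiv.sigmaCongrRight fun _ => Fin.revPerm)).trans
      (Equiv.sumSigmaDistrib fun a => Fin (Sum.elim ν ν a)).symm
  basis_apply := by
    rintro ⟨c | c, k⟩
    · exact (Basis.reindex_apply _ _ _).trans (S.basis_inl ⟨c, k⟩)
    · refine (Basis.reindex_apply _ _ _).trans ((S.basis_inr ⟨c, Fin.rev k⟩).trans ?_)
      exact congrArg (fun j => (P ^ j) (S.fgen c)) (sub_one_sub_rev (n := ν c) k)
  pow_gen := by
    rintro (c | c)
    · exact S.pow_egen c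
    · exact S.pow_fgen c

theorem pow_egen_of_lt {c : κ} {k : ℕ} (h : k < ν c) :
    (P ^ k) (S.egen c) = S.basis (Sum.inl ⟨c, ⟨k, h⟩⟩) := (S.basis_inl ⟨c, ⟨k, h⟩⟩).symm

theorem pow_egen_of_le {c : κ} {k : ℕ} (h : ν c ≤ k) : (P ^ k) (S.egen c) = 0 :=
  S.ambientJordanBasis.pow_gen_of_le (a := Sum.inl c) h

theorem basis_inl_mem (x : Σ c, Fin (ν c)) : S.basis (Sum.inl x) ∈ S.lagrangian :=
  Submodule.subset_span ⟨x, rfl⟩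

theorem pow_egen_mem (c : κ) (k : ℕ) : (P ^ k) (S.egen c) ∈ S.lagrangian := by
  rcases lt_or_ge k (ν c) with h | h
  · rw [S.pow_egen_of_lt h]
    exact S.basis_inl_mem _
  · rw [S.pow_egen_of_le h]
    exact Submodule.zero_mem _

theorem linearIndependent_inl :
    LinearIndependent K fun x => S.basis (Sum.inl x) :=
  S.basis.linearIndependent.comp _ Sum.inl_injective

theorem isInvariantLagrangian [Fintype κ] : IsInvariantLagrangian B P S.lagrangian where
  isotropic := by
    intro u hu v hv
    have h1 : ∀ x, ∀ v ∈ S.lagrangian, B (S.basis (Sum.inl x)) v = 0 := by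
      intro x v hv
      induction hv using Submodule.span_induction with
      | mem v hv =>
        obtain ⟨y, rfl⟩ := hv
        exact S.form_inl_inl x y
      | zero => rw [map_zero]
      | add v w _ _ h1 h2 => rw [map_add, h1, h2, add_zero]
      | smul c v _ h1 => rw [map_smul, h1, smul_zero]
    induction hu using Submodule.span_induction with
    | mem u hu =>
      obtain ⟨x, rfl⟩ := hu
      exact h1 x v hv
    | zero => rw [map_zero, LinearMap.zero_apply]
    | add u w _ _ h1 h2 => rw [map_add, LinearMap.add_apply, h1, h2, add_zero]
    | smul c u _ h1 => rw [map_smul, LinearMap.smul_apply, h1, smul_zero]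
  invariant := by
    have h : S.lagrangian ≤ S.lagrangian.comap P := by
      refine Submodule.span_le.mpr ?_
      rintro _ ⟨x, rfl⟩
      change P (S.basis (Sum.inl x)) ∈ S.lagrangian
      rw [S.basis_inl, ← Module.End.mul_apply, ← pow_succ']
      exact S.pow_egen_mem _ _
    exact h
  finrank_eq := by
    rw [lagrangian, finrank_span_eq_card S.linearIndependent_inl, finrank_eq_card_basis S.basis,
      Fintype.card_sum, two_mul]

/-- The Jordan basis of the span of the first half of the basis. -/
def lagrangianJordanBasis (hinv : ∀ u ∈ S.lagrangian, P u ∈ S.lagrangian) :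
    JordanBasis (P.restrict hinv) ν where
  gen := fun c => ⟨S.egen c, S.pow_egen_mem c 0⟩
  basis := Basis.span S.linearIndependent_inl
  basis_apply := fun x => Subtype.ext <| by
    rw [coe_restrict_pow, ← S.basis_inl]
    exact congrArg Subtype.val (Basis.span_apply S.linearIndependent_inl x)
  pow_gen := fun c => Subtype.ext <| by
    rw [coe_restrict_pow]
    exact S.pow_egen c

/-- The chains of the `fgen c` span a `P`-invariant complement, so the projection that kills them is
equivariant. -/
theorem exists_projection (hinv : ∀ u ∈ S.lagrangian, P u ∈ S.lagrangian) :
    ∃ p : V →ₗ[K] S.lagrangian, (∀ u : S.lagrangian, p u = u) ∧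
      ∀ u, p (P u) = P.restrict hinv (p u) := by
  obtain ⟨p, hpP, hp⟩ := S.ambientJordanBasis.exists_intertwiner (ψ := P.restrict hinv)
    (Sum.elim (fun c => ⟨S.egen c, S.pow_egen_mem c 0⟩) 0) (by
      rintro (c | c)
      · exact (S.lagrangianJordanBasis hinv).pow_gen c
      · exact map_zero _)
  refine ⟨p, fun u => ?_, fun u => (hpP u).symm⟩
  have h : p ∘ₗ S.lagrangian.subtype = LinearMap.id :=
    (S.lagrangianJordanBasis hinv).hom_ext fun c k => by
      rw [LinearMap.comp_apply, Submodule.subtype_apply, coe_restrict_pow, ← intertwiners_pow hpP,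
        LinearMap.id_apply]
      exact congrArg _ (hp (Sum.inl c))
  exact LinearMap.congr_fun h u

end DarbouxChains

variable [FiniteDimensional K V] {B : LinearMap.BilinForm K V} {P : V →ₗ[K] V}
  {L : Submodule K V}

theorem JordanBasis.finrank_intertwiners_self [Fintype κ] {φ : V →ₗ[K] V} {μ : κ → ℕ}
    (J : JordanBasis φ μ) : finrank K (intertwiners φ φ) = ∑ a, ∑ b, min (μ a) (μ b) := by
  rw [J.finrank_intertwiners]
  exact Finset.sum_congr rfl fun a _ => J.finrank_ker_pow _

/-- The ambient space has every block size twice, so its kernels of powers are twice as large as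
those in `L`. -/
theorem IsInvariantLagrangian.exists_darbouxChains_of_jordanBasis [CharZero K] [Fintype κ]
    (h : IsSymplecticPair B P) (hL : IsInvariantLagrangian B P L) {ν : κ → ℕ} (hν : ∀ c, 0 < ν c)
    (S₀ : DarbouxChains B P ν) (J : JordanBasis (P.restrict hL.invariant) ν) :
    ∃ S : DarbouxChains B P ν, S.lagrangian = L :=
  hL.exists_darbouxChains h hν J fun k => by
    rw [J.finrank_ker_pow, S₀.ambientJordanBasis.finrank_ker_pow, Fintype.sum_sum_type]
    simp only [Sum.elim_inl, Sum.elim_inr]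
    ring

/-- Among the invariant Lagrangian subspaces, exactly those that come from Darboux bases consisting
of Jordan chains have the restriction map of largest rank. -/
theorem IsInvariantLagrangian.finrank_lt_or_exists_darbouxChains [CharZero K] [Fintype κ]
    (h : IsSymplecticPair B P) (hL : IsInvariantLagrangian B P L) {ν : κ → ℕ} (hν : ∀ c, 0 < ν c)
    (S₀ : DarbouxChains B P ν) :
    finrank K ((skewCommutant B P).map (operatorForm B L)) <
        finrank K ((skewCommutant B P).map (operatorForm B S₀.lagrangian)) ∨
      finrank K ((skewCommutant B P).map (operatorForm B L)) ≤
        finrank K ((skewCommutant B P).map (operatorForm B S₀.lagrangian)) ∧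
      ∃ S : DarbouxChains B P ν, S.lagrangian = L := by
  have hnil : (P.restrict hL.invariant) ^ (∑ a, Sum.elim ν ν a) = 0 := by
    refine LinearMap.ext fun u => Subtype.ext ?_
    rw [coe_restrict_pow, S₀.ambientJordanBasis.exists_pow_eq_zero]
    rfl
  obtain ⟨d, μ', ⟨J'⟩⟩ := exists_jordanBasis _ hnil
  -- Blocks of size zero are dropped, since the comparison of partitions requires positive parts.
  have J := J'.pos
  have hL₀ := S₀.isInvariantLagrangian
  have J₀ := S₀.lagrangianJordanBasis hL₀.invariant
  obtain ⟨p, hp, hpP⟩ := S₀.exists_projection hL₀.invariant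
  have h2 := hL₀.le_two_mul_finrank h J₀ p hp hpP
  have h3 := hL.finrank_eq
  have h4 := hL₀.finrank_eq
  rw [J₀.finrank_intertwiners_self, J₀.finrank_intertwiners] at h2
  simp only [S₀.ambientJordanBasis.finrank_ker_pow, Fintype.sum_sum_type, Sum.elim_inl,
    Sum.elim_inr, Finset.sum_add_distrib] at h2
  have h1 : ∀ {d : Type} [Fintype d] {μ : d → ℕ}
      (J : JordanBasis (P.restrict hL.invariant) μ), 2 * finrank K
        ((skewCommutant B P).map (operatorForm B L)) + ∑ a, ∑ b, min (μ a) (μ b) ≤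
          2 * ∑ a, ∑ c, min (μ a) (ν c) + finrank K L := by
    intro d _ μ J
    have h1 := hL.two_mul_finrank_le h J
    rw [J.finrank_intertwiners_self, J.finrank_intertwiners] at h1
    simp only [S₀.ambientJordanBasis.finrank_ker_pow, Fintype.sum_sum_type, Sum.elim_inl,
      Sum.elim_inr, Finset.sum_add_distrib] at h1
    omega
  have h5 := h1 J
  rcases two_mul_sum_min_lt_or_exists_equiv (fun a : {a // 0 < μ' a} => μ' a) ν (fun a => a.2) hν
    with hlt | ⟨e, he⟩
  · left
    omega
  · right
    have h6 : ∑ a : {a // 0 < μ' a}, ∑ c, min (μ' a) (ν c) = ∑ a, ∑ c, min (ν a) (ν c) :=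
      Fintype.sum_equiv e _ _ fun a => by rw [he]
    have h7 : ∑ a : {a // 0 < μ' a}, ∑ b : {a // 0 < μ' a}, min (μ' a) (μ' b) =
        ∑ a, ∑ c, min (ν a) (ν c) :=
      Fintype.sum_equiv e _ _ fun a => Fintype.sum_equiv e _ _ fun b => by rw [he, he]
    exact ⟨by omega, hL.exists_darbouxChains_of_jordanBasis h hν S₀ (J.reindex e he)⟩

end Darboux

/-! ### The dimensions of the top rows determine the Jordan type. -/

section TopRow

open Module

variable {𝕜 : Type*} [RCLike 𝕜] {V : Type*} [AddCommGroup V] [Module 𝕜 V]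
  {κ : Type*} {B : LinearMap.BilinForm 𝕜 V} {P : V →ₗ[𝕜] V} {ν : κ → ℕ}

theorem mem_lowerPart_of_mem_range {m : ℕ} {u : V} (h : (P ^ m) (P u) = 0) :
    P u ∈ lowerPart P m :=
  Submodule.mem_sup_left ⟨h, u, rfl⟩

theorem mem_lowerPart_of_mem_ker {m : ℕ} {u : V} (h : (P ^ (m - 1)) u = 0) :
    u ∈ lowerPart P m :=
  Submodule.mem_sup_right h

/-- Moving powers of `P` across `B`: a vector of Im P is tested against `P ^ ν c` of `fgen c`, which
is 0, and a vector of Ker P^(ν c - 1) is killed directly. These functionals detect the generators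
modulo W. -/
theorem DarbouxChains.form_eq_zero_of_mem_lowerPart (h : IsSymplecticPair B P)
    (S : DarbouxChains B P ν) {c : κ} (hc : 0 < ν c) {u : V} (hu : u ∈ lowerPart P (ν c)) :
    B u ((P ^ (ν c - 1)) (S.fgen c)) = 0 := by
  obtain ⟨_, ⟨-, v, rfl⟩, w, hw, rfl⟩ := Submodule.mem_sup.mp hu
  rw [map_add, LinearMap.add_apply, h.adjoint, ← Module.End.mul_apply, ← pow_succ',
    Nat.sub_add_cancel hc, S.pow_fgen, map_zero, zero_add, ← h.adjoint_pow,
    LinearMap.mem_ker.mp hw, map_zero, LinearMap.zero_apply]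

theorem DarbouxChains.form_egen_fgen (S : DarbouxChains B P ν) (hν : ∀ c, 0 < ν c)
    [DecidableEq κ] (a c : κ) :
    B (S.egen a) ((P ^ (ν c - 1)) (S.fgen c)) = if a = c then 1 else 0 := by
  have h1 : S.egen a = S.basis (Sum.inl ⟨a, ⟨0, hν a⟩⟩) := S.pow_egen_of_lt (hν a)
  have h2 : (P ^ (ν c - 1)) (S.fgen c) = S.basis (Sum.inr ⟨c, ⟨0, hν c⟩⟩) :=
    (S.basis_inr ⟨c, ⟨0, hν c⟩⟩).symm
  rw [h1, h2]
  split_ifs with e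
  · subst e
    exact S.form_inl_inr_self _
  · refine S.form_inl_inr_of_ne _ _ fun h => e ?_
    exact congrArg Sigma.fst h

variable [Fintype κ]

theorem DarbouxChains.topRowDim_lagrangian (h : IsSymplecticPair B P) (hν : ∀ c, 0 < ν c)
    (S : DarbouxChains B P ν) (m : ℕ) :
    topRowDim P S.lagrangian m = Fintype.card {c // ν c = m} := by
  classical
  let q : {c // ν c = m} → V ⧸ lowerPart P m := fun c => (lowerPart P m).mkQ (S.egen c)
  have hq : LinearIndependent 𝕜 q := by
    rw [Fintype.linearIndependent_iff]
    rintro a ha ⟨c, rfl⟩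
    have h1 : ∑ x : {x // ν x = ν c}, a x • S.egen x ∈ lowerPart P (ν c) := by
      rw [← Submodule.ker_mkQ (lowerPart P (ν c)), LinearMap.mem_ker, map_sum, ← ha]
      simp only [map_smul, q]
    have h2 := S.form_eq_zero_of_mem_lowerPart h (hν c) h1
    rw [map_sum, LinearMap.sum_apply, Finset.sum_eq_single ⟨c, rfl⟩ (fun x _ hx => by
      rw [map_smul, LinearMap.smul_apply, S.form_egen_fgen hν, if_neg fun e => hx (Subtype.ext e),
        smul_zero]) (by simp), map_smul, LinearMap.smul_apply, S.form_egen_fgen hν, if_pos rfl,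
      smul_eq_mul, mul_one] at h2
    exact h2
  have hinv := S.isInvariantLagrangian.invariant
  have hspan : (S.lagrangian ⊓ LinearMap.ker (P ^ m)).map (lowerPart P m).mkQ =
      Submodule.span 𝕜 (Set.range q) := by
    apply le_antisymm
    · have hJ := (S.lagrangianJordanBasis hinv).ker_pow m
      have h1 : S.lagrangian ⊓ LinearMap.ker (P ^ m) ≤
          (LinearMap.ker ((P.restrict hinv) ^ m)).map S.lagrangian.subtype := by
        rintro u ⟨hu, hk⟩
        refine ⟨⟨u, hu⟩, ?_, rfl⟩
        refine LinearMap.mem_ker.mpr (Subtype.ext ?_)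
        rw [coe_restrict_pow]
        exact hk
      refine (Submodule.map_mono h1).trans ?_
      rw [hJ, Submodule.map_span, Submodule.map_span, Submodule.span_le]
      rintro _ ⟨_, ⟨_, ⟨⟨c, k⟩, hx, rfl⟩, rfl⟩, rfl⟩
      have hx : ν c ≤ m + k := hx
      rw [JordanBasis.basis_apply, Submodule.subtype_apply, coe_restrict_pow]
      change (lowerPart P m).mkQ ((P ^ (k : ℕ)) (S.egen c)) ∈ _
      -- Only the generators of chains of length exactly `m` survive: shorter chains lie in Ker
      -- P^(m-1), and later vectors of a chain lie in Im P.
      rcases Nat.eq_zero_or_pos (k : ℕ) with hk | hk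
      · rw [hk, pow_zero, Module.End.one_apply]
        rcases (show ν c ≤ m by omega).eq_or_lt with hm | hm
        · exact Submodule.subset_span ⟨⟨c, hm⟩, rfl⟩
        · have h2 : S.egen c ∈ lowerPart P m :=
            mem_lowerPart_of_mem_ker (S.pow_egen_of_le (by omega))
          rw [Submodule.mkQ_apply, (Submodule.Quotient.mk_eq_zero _).mpr h2]
          exact Submodule.zero_mem _
      · have h2 : (P ^ (k : ℕ)) (S.egen c) ∈ lowerPart P m := by
          obtain ⟨j, hj⟩ := Nat.exists_eq_add_of_lt hk
          rw [zero_add] at hj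
          rw [hj, pow_succ', Module.End.mul_apply]
          refine mem_lowerPart_of_mem_range ?_
          rw [← Module.End.mul_apply P, ← pow_succ', ← hj, ← Module.End.mul_apply, ← pow_add]
          exact S.pow_egen_of_le hx
        rw [Submodule.mkQ_apply, (Submodule.Quotient.mk_eq_zero _).mpr h2]
        exact Submodule.zero_mem _
    · rw [Submodule.span_le]
      rintro _ ⟨⟨c, rfl⟩, rfl⟩
      exact ⟨S.egen c, ⟨S.pow_egen_mem c 0, S.pow_egen c⟩, rfl⟩
  rw [topRowDim, hspan, finrank_span_eq_card hq]

variable [FiniteDimensional 𝕜 V]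

/-- If the top rows of `L` are as large as those of the span of the first half of a Darboux basis
consisting of Jordan chains, then `L` has the same Jordan type. -/
theorem IsInvariantLagrangian.exists_jordanBasis_of_topRowDim_eq {L : Submodule 𝕜 V}
    (hL : IsInvariantLagrangian B P L) (hν : ∀ c, 0 < ν c) (S : DarbouxChains B P ν)
    (htop : ∀ c, topRowDim P L (ν c) = Fintype.card {a // ν a = ν c}) :
    Nonempty (JordanBasis (P.restrict hL.invariant) ν) := by
  classical
  have hex : ∀ m, ∃ g : {c // ν c = m} → V, (∀ c, g c ∈ L ⊓ LinearMap.ker (P ^ m)) ∧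
      LinearIndependent 𝕜 fun c => (lowerPart P m).mkQ (g c) := by
    intro m
    rcases isEmpty_or_nonempty {c // ν c = m} with he | ⟨⟨c, rfl⟩⟩
    · exact ⟨fun c => he.elim c, fun c => he.elim c, linearIndependent_empty_type⟩
    · let b := (finBasis 𝕜 ((L ⊓ LinearMap.ker (P ^ ν c)).map (lowerPart P (ν c)).mkQ)).reindex
        (Fintype.equivOfCardEq (β := {a // ν a = ν c}) (by
          rw [Fintype.card_fin, ← htop c]
          rfl))
      choose g hg hgb using fun a => (b a).2
      refine ⟨g, hg, ?_⟩
      simp only [hgb]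
      exact b.linearIndependent.map' (Submodule.subtype _) (Submodule.ker_subtype _)
  choose g' hg' hli' using hex
  let g : κ → V := fun c => g' (ν c) ⟨c, rfl⟩
  have hg : ∀ c, g c ∈ L ∧ (P ^ ν c) (g c) = 0 := fun c => hg' (ν c) ⟨c, rfl⟩
  have hgm : ∀ m (c : {c // ν c = m}), g c = g' m c := by
    rintro m ⟨c, rfl⟩
    rfl
  have hli : LinearIndependent 𝕜 fun c => (P ^ (ν c - 1)) (g c) := by
    rw [Fintype.linearIndependent_iff]
    intro a ha
    by_contra! hne
    obtain ⟨c₁, hc₁⟩ := hne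
    -- Let `m` be the shortest length in the support of a relation between chain ends. Undoing `P ^
    -- (m - 1)` gives an element of Ker P^(m-1), hence of W. The longer chains contribute elements
    -- of Im P ∩ Ker P^m, also in W, so a relation modulo W between the generators of length `m`
    -- remains.
    obtain ⟨c₀, hc₀, hmin⟩ := Finset.exists_min_image (Finset.univ.filter fun c => a c ≠ 0) ν
      ⟨c₁, by simpa using hc₁⟩
    have hc₀ : a c₀ ≠ 0 := (Finset.mem_filter.mp hc₀).2
    have hmin : ∀ c, a c ≠ 0 → ν c₀ ≤ ν c := fun c hc =>
      hmin c (Finset.mem_filter.mpr ⟨Finset.mem_univ _, hc⟩)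
    set m := ν c₀ with hm
    have hmpos : 0 < m := hν c₀
    have hu : (lowerPart P m).mkQ (∑ c, a c • (P ^ (ν c - m)) (g c)) = 0 := by
      rw [Submodule.mkQ_apply, Submodule.Quotient.mk_eq_zero]
      refine mem_lowerPart_of_mem_ker ?_
      rw [map_sum, ← ha]
      refine Finset.sum_congr rfl fun c _ => ?_
      by_cases hc : a c = 0
      · rw [hc, zero_smul, zero_smul, map_zero]
      · have := hmin c hc
        rw [map_smul, ← Module.End.mul_apply, ← pow_add,
          show m - 1 + (ν c - m) = ν c - 1 by omega]
    have hterm : ∀ c, (lowerPart P m).mkQ (a c • (P ^ (ν c - m)) (g c)) =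
        if ν c = m then a c • (lowerPart P m).mkQ (g c) else 0 := by
      intro c
      by_cases hc : a c = 0
      · rw [hc, zero_smul, zero_smul, map_zero, ite_self]
      · have hle := hmin c hc
        split_ifs with e
        · rw [e, Nat.sub_self, pow_zero, Module.End.one_apply, map_smul]
        · rw [map_smul, Submodule.mkQ_apply, (Submodule.Quotient.mk_eq_zero _).mpr, smul_zero]
          rw [show ν c - m = (ν c - m - 1) + 1 by omega, pow_succ', Module.End.mul_apply]
          refine mem_lowerPart_of_mem_range ?_
          rw [← Module.End.mul_apply P, ← pow_succ', ← Module.End.mul_apply, ← pow_add,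
            show m + (ν c - m - 1 + 1) = ν c by omega]
          exact (hg c).2
    rw [map_sum, Finset.sum_congr rfl fun c _ => hterm c, ← Finset.sum_filter,
      Finset.sum_subtype (p := fun c => ν c = m) _ (by simp)] at hu
    have hzero := Fintype.linearIndependent_iff.mp (hli' m) (fun c => a c) (by
      rw [← hu]
      exact Finset.sum_congr rfl fun c _ => by rw [hgm])
    exact hc₀ (hzero ⟨c₀, rfl⟩)
  obtain ⟨J, -⟩ := exists_jordanBasis_of_linearIndependent (P.restrict hL.invariant) ν
    (fun c => ⟨g c, (hg c).1⟩) (fun c => Subtype.ext (by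
      rw [coe_restrict_pow]
      exact (hg c).2)) (by
      refine LinearIndependent.of_comp L.subtype ?_
      have h1 := hli.comp (Subtype.val : {c // 0 < ν c} → κ) Subtype.val_injective
      convert h1 using 1
      funext c
      rw [Function.comp_apply, Submodule.subtype_apply, coe_restrict_pow]
      rfl) (by
      have h1 := hL.finrank_eq
      have h2 := S.isInvariantLagrangian.finrank_eq
      have h3 := (S.lagrangianJordanBasis S.isInvariantLagrangian.invariant).finrank_eq
      omega)
  exact ⟨J⟩

end TopRow

/-! ### Standard bases and Darboux bases of chains are the same. -/

section StandardBasis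

open Module

variable {𝕜 : Type*} [RCLike 𝕜] {V : Type*} [AddCommGroup V] [Module 𝕜 V]
  {A B : LinearMap.BilinForm 𝕜 V} {P : V →ₗ[𝕜] V} {t : ℕ} {n l : Fin t → ℕ}

/-- The Jordan blocks of a sum with `l i` blocks of half-size `n i`. -/
abbrev JordanBlock (l : Fin t → ℕ) : Type := Σ i : Fin t, Fin (l i)

/-- The half-size of a block. -/
abbrev blockSize (n l : Fin t → ℕ) (c : JordanBlock l) : ℕ := n c.1

/-- A vector of the first half of a standard basis is given by a block and a position in it. -/
def blockIndexEquiv (n l : Fin t → ℕ) :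
    (Σ c : JordanBlock l, Fin (blockSize n l c)) ≃ BlockIndex n l where
  toFun x := ⟨x.1.1, (x.1.2, x.2)⟩
  invFun y := ⟨⟨y.1, y.2.1⟩, y.2.2⟩
  left_inv _ := rfl
  right_inv _ := rfl

theorem jordanMatrix_blockIndexEquiv (x y : Σ c : JordanBlock l, Fin (blockSize n l c)) :
    jordanMatrix 𝕜 n l (blockIndexEquiv n l x) (blockIndexEquiv n l y) =
      if x.1 = y.1 ∧ (x.2 : ℕ) + 1 = y.2 then 1 else 0 := by
  obtain ⟨⟨i, j⟩, k⟩ := x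
  obtain ⟨⟨i', j'⟩, k'⟩ := y
  change (if i = i' ∧ (j : ℕ) = j' ∧ (k : ℕ) + 1 = k' then (1 : 𝕜) else 0) = _
  refine if_congr ?_ rfl rfl
  rw [← and_assoc]
  refine and_congr_left fun _ => ⟨?_, ?_⟩
  · rintro ⟨rfl, e⟩
    rw [Fin.ext e]
  · intro e
    cases e
    exact ⟨rfl, rfl⟩

/-- The values of the forms on a standard basis, for the indexing by blocks. -/
structure IsStandardFamily (A B : LinearMap.BilinForm 𝕜 V) (n l : Fin t → ℕ)
    (e f : (Σ c : JordanBlock l, Fin (blockSize n l c)) → V) : Prop where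
  left_inl_inl : ∀ x y, A (e x) (e y) = 0
  left_inr_inr : ∀ x y, A (f x) (f y) = 0
  left_inl_inr : ∀ x y, A (e x) (f y) = if x.1 = y.1 ∧ (x.2 : ℕ) + 1 = y.2 then 1 else 0
  left_inr_inl : ∀ x y, A (f y) (e x) = -A (e x) (f y)
  right_inl_inl : ∀ x y, B (e x) (e y) = 0
  right_inr_inr : ∀ x y, B (f x) (f y) = 0
  right_inl_inr : ∀ x y, B (e x) (f y) = if x = y then 1 else 0
  right_inr_inl : ∀ x y, B (f y) (e x) = -B (e x) (f y)

theorem isStandardBasis_iff {b : Basis (BlockIndex n l ⊕ BlockIndex n l) 𝕜 V} :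
    IsStandardBasis A B n l b ↔ IsStandardFamily A B n l
      (fun x => b (Sum.inl (blockIndexEquiv n l x)))
      (fun x => b (Sum.inr (blockIndexEquiv n l x))) := by
  constructor
  · rintro ⟨hA, hB⟩
    have hA' : ∀ i j, A (b i) (b j) = LinearMap.BilinForm.toMatrix b A i j := fun i j =>
      (LinearMap.BilinForm.toMatrix_apply b A i j).symm
    rw [hA] at hA'
    have hB' : ∀ i j, B (b i) (b j) = LinearMap.BilinForm.toMatrix b B i j := fun i j =>
      (LinearMap.BilinForm.toMatrix_apply b B i j).symm
    rw [hB] at hB'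
    constructor
    · intro x y; simp [hA']
    · intro x y; simp [hA']
    · intro x y; rw [hA', Matrix.fromBlocks_apply₁₂, jordanMatrix_blockIndexEquiv]
    · intro x y; simp [hA']
    · intro x y; simp [hB']
    · intro x y; simp [hB']
    · intro x y
      rw [hB', Matrix.fromBlocks_apply₁₂, Matrix.one_apply]
      exact if_congr (blockIndexEquiv n l).injective.eq_iff rfl rfl
    · intro x y
      simp only [hB', Matrix.fromBlocks_apply₁₂, Matrix.fromBlocks_apply₂₁, Matrix.neg_apply,
        Matrix.one_apply, eq_comm]
  · intro H
    constructor
    · ext i j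
      rw [LinearMap.BilinForm.toMatrix_apply]
      rcases i with i | i <;> rcases j with j | j <;>
        obtain ⟨x, rfl⟩ := (blockIndexEquiv n l).surjective i <;>
        obtain ⟨y, rfl⟩ := (blockIndexEquiv n l).surjective j
      · exact H.left_inl_inl x y
      · rw [Matrix.fromBlocks_apply₁₂, jordanMatrix_blockIndexEquiv]
        exact H.left_inl_inr x y
      · rw [Matrix.fromBlocks_apply₂₁, Matrix.neg_apply, Matrix.transpose_apply,
          jordanMatrix_blockIndexEquiv, ← H.left_inl_inr y x]
        exact H.left_inr_inl y x
      · exact H.left_inr_inr x y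
    · ext i j
      rw [LinearMap.BilinForm.toMatrix_apply]
      rcases i with i | i <;> rcases j with j | j <;>
        obtain ⟨x, rfl⟩ := (blockIndexEquiv n l).surjective i <;>
        obtain ⟨y, rfl⟩ := (blockIndexEquiv n l).surjective j
      · exact H.right_inl_inl x y
      · rw [Matrix.fromBlocks_apply₁₂, Matrix.one_apply]
        refine (H.right_inl_inr x y).trans ?_
        exact if_congr (blockIndexEquiv n l).injective.eq_iff.symm rfl rfl
      · rw [Matrix.fromBlocks_apply₂₁, Matrix.neg_apply, Matrix.one_apply]
        refine (H.right_inr_inl y x).trans ?_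
        rw [H.right_inl_inr]
        congr 1
        exact if_congr (eq_comm.trans (blockIndexEquiv n l).injective.eq_iff.symm) rfl rfl
      · exact H.right_inr_inr x y

/-- The span of the first half of a basis. -/
theorem span_range_blockIndexEquiv (e : BlockIndex n l → V) :
    Submodule.span 𝕜 (Set.range fun x => e (blockIndexEquiv n l x)) =
      Submodule.span 𝕜 (Set.range e) := by
  congr 1
  exact (blockIndexEquiv n l).surjective.range_comp e

theorem DarbouxChains.apply_basis_inl {κ : Type*} {ν : κ → ℕ} (S : DarbouxChains B P ν)
    (x : Σ c, Fin (ν c)) :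
    P (S.basis (Sum.inl x)) =
      if h : (x.2 : ℕ) + 1 < ν x.1 then S.basis (Sum.inl ⟨x.1, ⟨x.2 + 1, h⟩⟩) else 0 := by
  rw [S.basis_inl, ← Module.End.mul_apply, ← pow_succ']
  split_ifs with h
  · rw [S.basis_inl]
  · rw [show (x.2 : ℕ) + 1 = ν x.1 by have := x.2.2; omega, S.pow_egen]

theorem DarbouxChains.apply_basis_inr {κ : Type*} {ν : κ → ℕ} (S : DarbouxChains B P ν)
    (x : Σ c, Fin (ν c)) :
    P (S.basis (Sum.inr x)) =
      if 0 < (x.2 : ℕ) then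
        S.basis (Sum.inr ⟨x.1, ⟨x.2 - 1, (Nat.sub_le _ _).trans_lt x.2.2⟩⟩) else 0 := by
  rw [S.basis_inr, ← Module.End.mul_apply, ← pow_succ']
  have := x.2.2
  split_ifs with h
  · rw [S.basis_inr]
    congr 2
    change _ = ν x.1 - 1 - ((x.2 : ℕ) - 1)
    omega
  · rw [show ν x.1 - 1 - (x.2 : ℕ) + 1 = ν x.1 by omega, S.pow_fgen]

/-- The standard basis formed by Jordan chains. -/
def DarbouxChains.standardBasis (S : DarbouxChains B P (blockSize n l)) :
    Basis (BlockIndex n l ⊕ BlockIndex n l) 𝕜 V :=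
  S.basis.reindex ((blockIndexEquiv n l).sumCongr (blockIndexEquiv n l))

theorem DarbouxChains.standardBasis_inl (S : DarbouxChains B P (blockSize n l))
    (x : Σ c : JordanBlock l, Fin (blockSize n l c)) :
    S.standardBasis (Sum.inl (blockIndexEquiv n l x)) = S.basis (Sum.inl x) := by
  simp [standardBasis]

theorem DarbouxChains.standardBasis_inr (S : DarbouxChains B P (blockSize n l))
    (x : Σ c : JordanBlock l, Fin (blockSize n l c)) :
    S.standardBasis (Sum.inr (blockIndexEquiv n l x)) = S.basis (Sum.inr x) := by
  simp [standardBasis]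

theorem DarbouxChains.span_standardBasis_inl (S : DarbouxChains B P (blockSize n l)) :
    Submodule.span 𝕜 (Set.range fun x => S.standardBasis (Sum.inl x)) = S.lagrangian := by
  rw [← span_range_blockIndexEquiv]
  simp only [S.standardBasis_inl]
  rfl

theorem DarbouxChains.isStandardBasis (h : IsSymplecticPair B P)
    (hP : ∀ u v, B (P u) v = A u v) (S : DarbouxChains B P (blockSize n l)) :
    IsStandardBasis A B n l S.standardBasis := by
  rw [isStandardBasis_iff]
  simp only [S.standardBasis_inl, S.standardBasis_inr]
  constructor
  · intro x y
    rw [← hP, S.apply_basis_inl]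
    split_ifs
    · exact S.form_inl_inl _ _
    · simp
  · intro x y
    rw [← hP, S.apply_basis_inr]
    split_ifs
    · exact S.form_inr_inr _ _
    · simp
  · intro x y
    rw [← hP, S.apply_basis_inl]
    obtain ⟨c, k⟩ := x
    obtain ⟨c', k'⟩ := y
    split_ifs with h1 h2 h2
    · obtain ⟨rfl, h3⟩ := h2
      rw [show k' = ⟨k + 1, h1⟩ from Fin.ext h3.symm]
      exact S.form_inl_inr_self _
    · refine S.form_inl_inr_of_ne _ _ fun e => h2 ?_
      cases e
      exact ⟨rfl, rfl⟩
    · obtain ⟨rfl, h3⟩ := h2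
      exact absurd (h3.trans_lt k'.2) h1
    · simp
  · intro x y
    rw [← hP, ← hP, h.skew, h.adjoint]
  · exact S.form_inl_inl
  · exact S.form_inr_inr
  · intro x y
    split_ifs with e
    · rw [e]
      exact S.form_inl_inr_self _
    · exact S.form_inl_inr_of_ne _ _ e
  · intro x y
    exact h.skew _ _

theorem form_skew_of_basis {ι : Type*} {F : LinearMap.BilinForm 𝕜 V} (b : Basis ι 𝕜 V)
    (hb : ∀ i j, F (b i) (b j) = -F (b j) (b i)) (u v : V) : F u v = -F v u := by
  have : F = -F.flip := b.ext fun i => b.ext fun j => hb i j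
  exact LinearMap.congr_fun (LinearMap.congr_fun this u) v

theorem IsStandardBasis.left_skew {b : Basis (BlockIndex n l ⊕ BlockIndex n l) 𝕜 V}
    (hb : IsStandardBasis A B n l b) (u v : V) : A u v = -A v u := by
  have H := isStandardBasis_iff.mp hb
  refine form_skew_of_basis b (fun i j => ?_) u v
  rcases i with i | i <;> rcases j with j | j <;>
    obtain ⟨x, rfl⟩ := (blockIndexEquiv n l).surjective i <;>
    obtain ⟨y, rfl⟩ := (blockIndexEquiv n l).surjective j
  · rw [H.left_inl_inl, H.left_inl_inl, neg_zero]
  · rw [H.left_inr_inl, neg_neg]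
  · rw [H.left_inr_inl]
  · rw [H.left_inr_inr, H.left_inr_inr, neg_zero]

theorem IsStandardBasis.right_skew {b : Basis (BlockIndex n l ⊕ BlockIndex n l) 𝕜 V}
    (hb : IsStandardBasis A B n l b) (u v : V) : B u v = -B v u := by
  have H := isStandardBasis_iff.mp hb
  refine form_skew_of_basis b (fun i j => ?_) u v
  rcases i with i | i <;> rcases j with j | j <;>
    obtain ⟨x, rfl⟩ := (blockIndexEquiv n l).surjective i <;>
    obtain ⟨y, rfl⟩ := (blockIndexEquiv n l).surjective j
  · rw [H.right_inl_inl, H.right_inl_inl, neg_zero]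
  · rw [H.right_inr_inl, neg_neg]
  · rw [H.right_inr_inl]
  · rw [H.right_inr_inr, H.right_inr_inr, neg_zero]

theorem IsStandardBasis.isSymplecticPair {b : Basis (BlockIndex n l ⊕ BlockIndex n l) 𝕜 V}
    (hb : IsStandardBasis A B n l b) (hP : ∀ u v, B (P u) v = A u v) : IsSymplecticPair B P where
  nondegenerate := IsJordanSum.nondegenerate ⟨b, hb⟩
  skew := hb.right_skew
  adjoint u v := by rw [hP, hb.left_skew, ← hP, hb.right_skew, neg_neg]

theorem IsStandardBasis.ext_right {b : Basis (BlockIndex n l ⊕ BlockIndex n l) 𝕜 V}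
    (hb : IsStandardBasis A B n l b) {u v : V}
    (hl : ∀ x, B u (b (Sum.inl (blockIndexEquiv n l x))) =
      B v (b (Sum.inl (blockIndexEquiv n l x))))
    (hr : ∀ x, B u (b (Sum.inr (blockIndexEquiv n l x))) =
      B v (b (Sum.inr (blockIndexEquiv n l x)))) : u = v := by
  have hnd : B.Nondegenerate := IsJordanSum.nondegenerate ⟨b, hb⟩
  have : B u = B v := by
    refine b.ext fun i => ?_
    rcases i with i | i <;> obtain ⟨x, rfl⟩ := (blockIndexEquiv n l).surjective i
    · exact hl x
    · exact hr x
  exact LinearMap.ker_eq_bot.mp hnd.ker_eq_bot this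

/-- `B (P e_k) f_{k+1} = A e_k f_{k+1} = 1` is the only nonzero pairing, so `P` raises the index of
the e-vectors. For the same reason it lowers that of the f-vectors, whose chains therefore start at
the last index. -/
theorem IsStandardBasis.apply_inl {b : Basis (BlockIndex n l ⊕ BlockIndex n l) 𝕜 V}
    (hb : IsStandardBasis A B n l b) (hP : ∀ u v, B (P u) v = A u v) (c : JordanBlock l)
    (k : Fin (blockSize n l c)) :
    P (b (Sum.inl (blockIndexEquiv n l ⟨c, k⟩))) =
      if h : (k : ℕ) + 1 < blockSize n l c then
        b (Sum.inl (blockIndexEquiv n l ⟨c, ⟨k + 1, h⟩⟩)) else 0 := by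
  have H := isStandardBasis_iff.mp hb
  refine hb.ext_right (fun x => ?_) (fun x => ?_)
  · rw [hP, H.left_inl_inl]
    split_ifs
    · rw [H.right_inl_inl]
    · simp
  · obtain ⟨c', k'⟩ := x
    rw [hP, H.left_inl_inr]
    by_cases h1 : (k : ℕ) + 1 < blockSize n l c
    · rw [dif_pos h1, H.right_inl_inr]
      refine if_congr ⟨?_, ?_⟩ rfl rfl
      · rintro ⟨rfl, e⟩
        rw [show k' = ⟨k + 1, h1⟩ from Fin.ext e.symm]
      · intro e
        cases e
        exact ⟨rfl, rfl⟩
    · rw [dif_neg h1, map_zero, LinearMap.zero_apply, if_neg]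
      rintro ⟨rfl, e⟩
      exact h1 (e.trans_lt k'.2)

theorem IsStandardBasis.apply_inr {b : Basis (BlockIndex n l ⊕ BlockIndex n l) 𝕜 V}
    (hb : IsStandardBasis A B n l b) (hP : ∀ u v, B (P u) v = A u v) (c : JordanBlock l)
    (k : Fin (blockSize n l c)) :
    P (b (Sum.inr (blockIndexEquiv n l ⟨c, k⟩))) =
      if 0 < (k : ℕ) then
        b (Sum.inr (blockIndexEquiv n l ⟨c, ⟨k - 1, (Nat.sub_le _ _).trans_lt k.2⟩⟩))
      else 0 := by
  have H := isStandardBasis_iff.mp hb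
  refine hb.ext_right (fun x => ?_) (fun x => ?_)
  · obtain ⟨c', k'⟩ := x
    rw [hP, H.left_inr_inl, H.left_inl_inr]
    by_cases h1 : 0 < (k : ℕ)
    · rw [if_pos h1, H.right_inr_inl, H.right_inl_inr]
      congr 1
      refine if_congr ⟨?_, ?_⟩ rfl rfl
      · rintro ⟨rfl, e⟩
        have e : (k' : ℕ) + 1 = k := e
        rw [show k' = ⟨(k : ℕ) - 1, (Nat.sub_le _ _).trans_lt k.2⟩ from
          Fin.ext (by change (k' : ℕ) = k - 1; omega)]
      · intro e
        cases e
        exact ⟨rfl, Nat.sub_add_cancel h1⟩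
    · rw [if_neg h1, map_zero, LinearMap.zero_apply, if_neg, neg_zero]
      rintro ⟨-, e⟩
      have e : (k' : ℕ) + 1 = k := e
      omega
  · rw [hP, H.left_inr_inr]
    split_ifs
    · rw [H.right_inr_inr]
    · simp

theorem IsStandardBasis.pow_apply_inl {b : Basis (BlockIndex n l ⊕ BlockIndex n l) 𝕜 V}
    (hb : IsStandardBasis A B n l b) (hP : ∀ u v, B (P u) v = A u v) (c : JordanBlock l)
    (hc : 0 < blockSize n l c) (k : ℕ) (hk : k < blockSize n l c) :
    (P ^ k) (b (Sum.inl (blockIndexEquiv n l ⟨c, ⟨0, hc⟩⟩))) =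
      b (Sum.inl (blockIndexEquiv n l ⟨c, ⟨k, hk⟩⟩)) := by
  induction k with
  | zero => rfl
  | succ k ih => rw [pow_succ', Module.End.mul_apply, ih (k.lt_succ_self.trans hk),
      hb.apply_inl hP, dif_pos hk]

theorem IsStandardBasis.pow_apply_inr {b : Basis (BlockIndex n l ⊕ BlockIndex n l) 𝕜 V}
    (hb : IsStandardBasis A B n l b) (hP : ∀ u v, B (P u) v = A u v) (c : JordanBlock l)
    (hc : blockSize n l c - 1 < blockSize n l c) (k : ℕ) (hk : k < blockSize n l c) :
    (P ^ k) (b (Sum.inr (blockIndexEquiv n l ⟨c, ⟨blockSize n l c - 1, hc⟩⟩))) =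
      b (Sum.inr (blockIndexEquiv n l ⟨c, ⟨blockSize n l c - 1 - k,
        (Nat.sub_le _ _).trans_lt hc⟩⟩)) := by
  induction k with
  | zero => rfl
  | succ k ih =>
    rw [pow_succ', Module.End.mul_apply, ih (k.lt_succ_self.trans hk), hb.apply_inr hP, if_pos]
    · rfl
    · change 0 < blockSize n l c - 1 - k
      omega

/-- A standard basis consists of Jordan chains. -/
def IsStandardBasis.darbouxChains {b : Basis (BlockIndex n l ⊕ BlockIndex n l) 𝕜 V}
    (hb : IsStandardBasis A B n l b) (hP : ∀ u v, B (P u) v = A u v) (hn : ∀ i, 0 < n i) :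
    DarbouxChains B P (blockSize n l) where
  egen c := b (Sum.inl (blockIndexEquiv n l ⟨c, ⟨0, hn c.1⟩⟩))
  fgen c := b (Sum.inr
    (blockIndexEquiv n l ⟨c, ⟨blockSize n l c - 1, Nat.sub_one_lt (hn c.1).ne'⟩⟩))
  basis := b.reindex ((blockIndexEquiv n l).symm.sumCongr (blockIndexEquiv n l).symm)
  basis_inl x := by
    rw [hb.pow_apply_inl hP x.1 (hn x.1.1) x.2 x.2.2]
    simp
  basis_inr x := by
    have hx := x.2.2
    rw [hb.pow_apply_inr hP x.1 (Nat.sub_one_lt (hn x.1.1).ne') _ (by omega)]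
    have e : x = ⟨x.1, ⟨blockSize n l x.1 - 1 - (blockSize n l x.1 - 1 - x.2), by omega⟩⟩ := by
      refine Sigma.ext rfl (heq_of_eq (Fin.ext ?_))
      change (x.2 : ℕ) = blockSize n l x.1 - 1 - (blockSize n l x.1 - 1 - x.2)
      omega
    conv_lhs => rw [e]
    simp
  pow_egen c := by
    have hc := hn c.1
    obtain ⟨m, hm⟩ : ∃ m, blockSize n l c = m + 1 := ⟨blockSize n l c - 1, by
      change n c.1 = n c.1 - 1 + 1; omega⟩
    rw [show P ^ blockSize n l c = P ^ (m + 1) by rw [hm], pow_succ', Module.End.mul_apply,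
      hb.pow_apply_inl hP c _ m (by omega), hb.apply_inl hP, dif_neg]
    change ¬ m + 1 < _
    omega
  pow_fgen c := by
    have hc := hn c.1
    obtain ⟨m, hm⟩ : ∃ m, blockSize n l c = m + 1 := ⟨blockSize n l c - 1, by
      change n c.1 = n c.1 - 1 + 1; omega⟩
    rw [show P ^ blockSize n l c = P ^ (m + 1) by rw [hm], pow_succ', Module.End.mul_apply,
      hb.pow_apply_inr hP c _ m (by omega), hb.apply_inr hP, if_neg]
    change ¬ 0 < blockSize n l c - 1 - m
    omega
  form_inl_inl x y := by
    simpa using (isStandardBasis_iff.mp hb).right_inl_inl x y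
  form_inr_inr x y := by
    simpa using (isStandardBasis_iff.mp hb).right_inr_inr x y
  form_inl_inr_self x := by
    simpa using (isStandardBasis_iff.mp hb).right_inl_inr x x
  form_inl_inr_of_ne x y e := by
    simpa [e] using (isStandardBasis_iff.mp hb).right_inl_inr x y

theorem IsStandardBasis.lagrangian_darbouxChains
    {b : Basis (BlockIndex n l ⊕ BlockIndex n l) 𝕜 V} (hb : IsStandardBasis A B n l b)
    (hP : ∀ u v, B (P u) v = A u v) (hn : ∀ i, 0 < n i) :
    (hb.darbouxChains hP hn).lagrangian =
      Submodule.span 𝕜 (Set.range fun x => b (Sum.inl x)) := by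
  rw [← span_range_blockIndexEquiv (e := fun x => b (Sum.inl x))]
  simp [DarbouxChains.lagrangian, IsStandardBasis.darbouxChains]

/-- The spans of the first halves of standard bases are those of Darboux bases of chains. -/
theorem exists_darbouxChains_iff_exists_isStandardBasis (h : IsSymplecticPair B P)
    (hP : ∀ u v, B (P u) v = A u v) (hn : ∀ i, 0 < n i) {L : Submodule 𝕜 V} :
    (∃ S : DarbouxChains B P (blockSize n l), S.lagrangian = L) ↔
      ∃ b : Basis (BlockIndex n l ⊕ BlockIndex n l) 𝕜 V, IsStandardBasis A B n l b ∧
        L = Submodule.span 𝕜 (Set.range fun x => b (Sum.inl x)) := by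
  constructor
  · rintro ⟨S, rfl⟩
    exact ⟨S.standardBasis, S.isStandardBasis h hP, S.span_standardBasis_inl.symm⟩
  · rintro ⟨b, hb, rfl⟩
    exact ⟨hb.darbouxChains hP hn, hb.lagrangian_darbouxChains hP hn⟩

/-- The sizes `n i` are distinct, so blocks of equal size belong to the same index. -/
theorem card_blockSize_eq (hn : Function.Injective n) (j : Fin t) :
    Fintype.card {c : JordanBlock l // blockSize n l c = n j} = l j := by
  conv_rhs => rw [← Fintype.card_fin (l j)]
  refine Fintype.card_congr ⟨fun c => Fin.cast (congrArg l (hn c.2)) c.1.2,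
    fun k => ⟨⟨j, k⟩, rfl⟩, ?_, ?_⟩
  · rintro ⟨⟨i, k⟩, hc⟩
    obtain rfl := hn hc
    rfl
  · intro k
    rfl

end StandardBasis

/-! ### Orbits of bi-Lagrangian subspaces and their dimensions. -/

section Orbits

open Module

variable {𝕜 : Type*} [RCLike 𝕜] {V : Type*} [AddCommGroup V] [Module 𝕜 V]
  {A B : LinearMap.BilinForm 𝕜 V} {P : V →ₗ[𝕜] V} {t : ℕ} {n l : Fin t → ℕ}

theorem infAut_eq_skewCommutant (h : IsSymplecticPair B P) (hP : ∀ u v, B (P u) v = A u v) :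
    infAut A B = skewCommutant B P := by
  have hinj := LinearMap.ker_eq_bot.mp h.nondegenerate.ker_eq_bot
  ext X
  constructor
  · rintro ⟨hA, hB⟩
    refine ⟨fun u => hinj (LinearMap.ext fun v => ?_), hB⟩
    rw [hP, hB, hP, hA]
  · rintro ⟨hc, hB⟩
    refine ⟨fun u v => ?_, hB⟩
    rw [← hP, hc, hB, hP]

/-- Both forms have the same Gram matrices in any two standard bases, so the map carrying one basis
to the other is an automorphism; conversely, automorphisms carry standard bases to standard bases.
-/
theorem autOrbit_standard {L L₀ : Submodule 𝕜 V}
    {b₀ : Basis (BlockIndex n l ⊕ BlockIndex n l) 𝕜 V} (hb₀ : IsStandardBasis A B n l b₀)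
    (hL₀ : L₀ = Submodule.span 𝕜 (Set.range fun x => b₀ (Sum.inl x))) :
    L ∈ autOrbit A B L₀ ↔
      ∃ b : Basis (BlockIndex n l ⊕ BlockIndex n l) 𝕜 V, IsStandardBasis A B n l b ∧
        L = Submodule.span 𝕜 (Set.range fun x => b (Sum.inl x)) := by
  have hmap (g : V ≃ₗ[𝕜] V) :
      L₀.map (g : V →ₗ[𝕜] V) = Submodule.span 𝕜 (Set.range fun x => g (b₀ (Sum.inl x))) := by
    rw [hL₀, Submodule.map_span, ← Set.range_comp]
    rfl
  constructor
  · rintro ⟨⟨g, hg⟩, rfl⟩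
    obtain ⟨hA, hB⟩ := mem_Aut_iff.mp hg
    refine ⟨b₀.map g, ⟨?_, ?_⟩, ?_⟩
    · rw [← hb₀.1]
      ext i j
      rw [LinearMap.BilinForm.toMatrix_apply, LinearMap.BilinForm.toMatrix_apply]
      exact hA _ _
    · rw [← hb₀.2]
      ext i j
      rw [LinearMap.BilinForm.toMatrix_apply, LinearMap.BilinForm.toMatrix_apply]
      exact hB _ _
    · exact hmap g
  · rintro ⟨b, hb, rfl⟩
    let g : V ≃ₗ[𝕜] V := b₀.equiv b (Equiv.refl _)
    have hgb (i) : g (b₀ i) = b i := b₀.equiv_apply i b (Equiv.refl _)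
    have key {F : LinearMap.BilinForm 𝕜 V}
        (hF : LinearMap.BilinForm.toMatrix b₀ F = LinearMap.BilinForm.toMatrix b F) (u v : V) :
        F (g u) (g v) = F u v := by
      have : F.compl₁₂ (g : V →ₗ[𝕜] V) (g : V →ₗ[𝕜] V) = F := b₀.ext fun i => b₀.ext fun j => by
        have := congrFun (congrFun hF i) j
        rw [LinearMap.BilinForm.toMatrix_apply, LinearMap.BilinForm.toMatrix_apply] at this
        rw [this, ← hgb, ← hgb]
        rfl
      exact LinearMap.congr_fun (LinearMap.congr_fun this u) v
    refine ⟨⟨g, mem_Aut_iff.mpr ⟨key (hb₀.1.trans hb.1.symm), key (hb₀.2.trans hb.2.symm)⟩⟩, ?_⟩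
    refine (hmap g).trans ?_
    simp only [hgb]

variable [FiniteDimensional 𝕜 V]

theorem pencilRank_eq (h : B.Nondegenerate) : pencilRank A B = finrank 𝕜 V := by
  refine le_antisymm (ciSup_le fun c => LinearMap.finrank_range_le _) ?_
  have hbdd : BddAbove (Set.range fun c : OnePoint 𝕜 =>
      finrank 𝕜 (LinearMap.range (pencilForm A B c))) :=
    ⟨finrank 𝕜 V, by rintro _ ⟨c, rfl⟩; exact LinearMap.finrank_range_le _⟩
  refine le_trans (le_of_eq ?_) (le_ciSup hbdd (none : OnePoint 𝕜))
  exact (LinearMap.finrank_range_of_inj (LinearMap.ker_eq_bot.mp h.ker_eq_bot)).symm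

/-- The pencil has full rank, so the dimension condition makes `L` Lagrangian for `B`. Vanishing of
`A = B(P·,·)` on `L` then says that `P` maps `L` into its orthogonal, which is `L`. -/
theorem mem_BLG_iff (h : IsSymplecticPair B P) (hP : ∀ u v, B (P u) v = A u v)
    {L : Submodule 𝕜 V} : L ∈ BLG A B ↔ IsInvariantLagrangian B P L := by
  have hdim : 2 * finrank 𝕜 L + pencilRank A B = 2 * finrank 𝕜 V ↔
      2 * finrank 𝕜 L = finrank 𝕜 V := by
    rw [pencilRank_eq h.nondegenerate]
    omega
  constructor
  · rintro ⟨hiso, hfin⟩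
    have hB : ∀ u ∈ L, ∀ v ∈ L, B u v = 0 := hiso none
    have hA : ∀ u ∈ L, ∀ v ∈ L, A u v = 0 := fun u hu v hv => by
      have := hiso (some 0) u hu v hv
      simpa [pencilForm] using this
    have hL : B.orthogonal L = L := by
      symm
      refine Submodule.eq_of_le_of_finrank_eq (fun u hu v hv => hB v hv u hu) ?_
      rw [LinearMap.BilinForm.finrank_orthogonal h.nondegenerate]
      have := hdim.mp hfin
      omega
    refine ⟨hB, fun u hu => ?_, hdim.mp hfin⟩
    rw [← hL]
    intro v hv
    change B v (P u) = 0
    rw [← h.adjoint, hP, hA v hv u hu]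
  · intro hL
    refine ⟨?_, hdim.mpr hL.finrank_eq⟩
    have hA : ∀ u ∈ L, ∀ v ∈ L, A u v = 0 := fun u hu v hv => by
      rw [← hP]
      exact hL.isotropic _ (hL.invariant u hu) v hv
    rintro (_ | c) u hu v hv
    · exact hL.isotropic u hu v hv
    · change A u v + c * B u v = 0
      rw [hA u hu v hv, hL.isotropic u hu v hv, mul_zero, add_zero]

/-- The tangent space of the orbit of `L` consists of the forms `B (X u) v` on `L`. -/
theorem orbitDim_eq (h : IsSymplecticPair B P) (hP : ∀ u v, B (P u) v = A u v)
    {L : Submodule 𝕜 V} (hL : IsInvariantLagrangian B P L) :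
    orbitDim A B L = finrank 𝕜 ((skewCommutant B P).map (operatorForm B L)) := by
  have e : skewCommutant B P ⊓ Subalgebra.toSubmodule (preserving 𝕜 L) =
      skewCommutant B P ⊓ LinearMap.ker (operatorForm B L) := by
    ext X
    exact and_congr_right fun _ => (hL.mem_ker_operatorForm h).symm
  have h1 := finrank_map_add_finrank_inf_ker (W := LinearMap.BilinForm 𝕜 L)
    (skewCommutant B P) (operatorForm B L)
  rw [orbitDim, groupDim, groupDim, lieAlg_autStab, lieAlg_Aut, infAut_eq_skewCommutant h hP, e]
  omega

end Orbits

end BiLagr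

end

/-! ### The theorem on the maximal orbit. -/

theorem theoremT {𝕜 : Type*} [RCLike 𝕜] {V : Type*} [AddCommGroup V] [Module 𝕜 V]
    [FiniteDimensional 𝕜 V] (A B : LinearMap.BilinForm 𝕜 V) {t : ℕ} (n l : Fin t → ℕ)
    (hn : StrictAnti n) (hn_pos : ∀ i, 0 < n i)
    (h : BiLagr.IsJordanSum A B n l) :
    ∃ Omax : Set (Submodule 𝕜 V),
      (BiLagr.IsTopOrbit A B Omax ∧ ∀ O, BiLagr.IsTopOrbit A B O → O = Omax) ∧
      ∀ L ∈ BiLagr.BLG A B,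
        [ L ∈ Omax,
          ∀ j, BiLagr.topRowDim (BiLagr.recursionOperator A B h.nondegenerate) L (n j) = l j,
          ∃ b : Module.Basis (BiLagr.BlockIndex n l ⊕ BiLagr.BlockIndex n l) 𝕜 V,
            BiLagr.IsStandardBasis A B n l b ∧
              L = Submodule.span 𝕜 (Set.range fun x => b (Sum.inl x)) ].TFAE := by
  have hP : ∀ u v, B (BiLagr.recursionOperator A B h.nondegenerate u) v = A u v := fun u v =>
    LinearMap.BilinForm.symmCompOfNondegenerate_left_apply A h.nondegenerate v u
  obtain ⟨b₀, hb₀⟩ := id h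
  generalize BiLagr.recursionOperator A B h.nondegenerate = P at hP ⊢
  have hs : BiLagr.IsSymplecticPair B P := hb₀.isSymplecticPair hP
  have hν : ∀ c : BiLagr.JordanBlock l, 0 < BiLagr.blockSize n l c := fun c => hn_pos c.1
  let S₀ : BiLagr.DarbouxChains B P (BiLagr.blockSize n l) := hb₀.darbouxChains hP hn_pos
  have hS₀ := S₀.isInvariantLagrangian
  have horbit (L : Submodule 𝕜 V) := BiLagr.autOrbit_standard (L := L) hb₀
    (hb₀.lagrangian_darbouxChains hP hn_pos)
  have hchains (L : Submodule 𝕜 V) := BiLagr.exists_darbouxChains_iff_exists_isStandardBasis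
    (n := n) (l := l) (L := L) hs hP hn_pos
  refine ⟨BiLagr.autOrbit A B S₀.lagrangian,
    ⟨⟨S₀.lagrangian, (BiLagr.mem_BLG_iff hs hP).mpr hS₀, rfl, ?_⟩, ?_⟩, ?_⟩
  · intro M hM
    have hM' := (BiLagr.mem_BLG_iff hs hP).mp hM
    rw [BiLagr.orbitDim_eq hs hP hM', BiLagr.orbitDim_eq hs hP hS₀]
    rcases hM'.finrank_lt_or_exists_darbouxChains hs hν S₀ with h1 | h1
    · exact h1.le
    · exact h1.1
  · rintro _ ⟨M, hM, rfl, hmax⟩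
    have hM' := (BiLagr.mem_BLG_iff hs hP).mp hM
    have h1 := hmax _ ((BiLagr.mem_BLG_iff hs hP).mpr hS₀)
    rw [BiLagr.orbitDim_eq hs hP hM', BiLagr.orbitDim_eq hs hP hS₀] at h1
    -- Maximality excludes a strictly smaller dimension, so `M` comes from a standard basis and lies
    -- in the orbit of the standard Lagrangian.
    rcases hM'.finrank_lt_or_exists_darbouxChains hs hν S₀ with h2 | h2
    · exact absurd h2 (not_lt.mpr h1)
    · exact MulAction.orbit_eq_iff.mpr ((horbit M).mpr ((hchains M).mp h2.2))
  · intro L hL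
    have hL' := (BiLagr.mem_BLG_iff hs hP).mp hL
    tfae_have 1 ↔ 3 := horbit L
    tfae_have 3 → 2 := by
      intro h3 j
      obtain ⟨S, rfl⟩ := (hchains L).mpr h3
      rw [S.topRowDim_lagrangian hs hν, BiLagr.card_blockSize_eq hn.injective]
    tfae_have 2 → 3 := by
      intro h2
      obtain ⟨J⟩ := hL'.exists_jordanBasis_of_topRowDim_eq hν S₀ fun c =>
        (h2 c.1).trans (BiLagr.card_blockSize_eq hn.injective c.1).symm
      exact (hchains L).mp (hL'.exists_darbouxChains_of_jordanBasis hs hν S₀ J)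
    tfae_finish
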